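/- Let $\mu,\sigma,\rho>0$, let $W$ be a standard Brownian motion, and put $A=\frac12\sigma^2\frac{d^2}{dx^2}+\mu\frac{d}{dx}$. Put $$r_1=\frac{-\mu+\sqrt{\mu^2+2\sigma^2\rho}}{\sigma^2},\quad r_2=\frac{\mu+\sqrt{\mu^2+2\sigma^2\rho}}{\sigma^2},\quad u_0=\frac1{r_1+r_2}\ln\frac{\rho+\mu r_2}{\rho-\mu r_1},$$ and let $V_0:\mathbb R\to\mathbb R$ be the solution of $(A-\rho)V_0=0$ with $V_0(u_0)=\mu/\rho$, $V_0'(u_0)=1$; it satisfies $V_0(0)=0$. For $x\ge 0$, $t>0$ let $p(x,t)=P(\tau_x<t)$, where $\tau_x$ is the first time at which $X(s)=x+\mu s+\sigma W(s)$ equals $0$. Let $h(x,t)$ be the classical solution of $\partial h/\partial t=Ah$ for $x,t>0$ with $h(0,t)=0$ and $h(x,0)=x$ that is continuous on $\{x\ge0,\ t\ge0\}$ and grows at most linearly in $x$, uniformly on bounded time intervals. Define, for $t>0$, $$\beta(t)=\Big[\frac{\partial h}{\partial x}(0,t)-e^{\rho t}V_0'(0)\Big]\Big/\frac{\partial p}{\partial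 x}(0,t).$$ For $\beta\le\beta(t)$ put $u_2(\beta,t)=u_0$; for $\beta>\beta(t)$ let $u_2(\beta,t)$ be the supremum of all $z\in\mathbb R$ such that $$\beta\{1-p(x,t)\}+h(x,t)\le e^{\rho t}V_0(x-z+u_0)\quad\text{for all }x\ge0,$$ and let $u_1(\beta,t)$ be the unique point $x>0$ at which equality holds here for $z=u_2(\beta,t)$. Let $0<K<\mu/\rho-u_0$. For $\Delta>0$ with $K<\mu/\rho-u_0-\beta(\Delta)$, let $\beta>\beta(\Delta)$ be the unique solution of $\beta+u_2(\beta,\Delta)=\mu/\rho-K$ and put $u_{1,K}(\Delta)=u_1(\beta,\Delta)$, $u_{2,K}(\Delta)=u_2(\beta,\Delta)$; for all other $\Delta>0$ put $u_{1,K}(\Delta)=0$, $u_{2,K}(\Delta)=u_0$. Let $z=\hat u_K$ be the unique solution of $V_0(z)=z+\mu/\rho-K-u_0$. Then $$\lim_{\Delta\to0^+}\frac{u_{1,K}(\Delta)}{\sigma\sqrt\Delta\,|\ln\Delta|^{1/2}}=1,\qquad \lim_{\Delta\to0^+}\frac{u_{2,K}(\Delta)-(u_0-\hat u_K)}{\sigma\sqrt\Delta\,|\ln\Delta|^{1/2}}=1.$$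 -/

import Mathlib

open MeasureTheory ProbabilityTheory Filter Topology
open scoped NNReal ENNReal

noncomputable section

namespace BankModel

/-- The generator `A = (σ² / 2) d²/dx² + μ d/dx` of the diffusion `dX = μ dt + σ dW`. -/
def gen (μ σ : ℝ) (f : ℝ → ℝ) (x : ℝ) : ℝ :=
  σ ^ 2 / 2 * deriv (deriv f) x + μ * deriv f x

/-! ### The threshold `u₀` and the function `V₀` -/

/-- The positive root of `σ² r² / 2 + μ r - ρ = 0`. -/
def r₁ (μ σ ρ : ℝ) : ℝ := (-μ + √(μ ^ 2 + 2 * σ ^ 2 * ρ)) / σ ^ 2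

/-- Minus the negative root of `σ² r² / 2 + μ r - ρ = 0`. -/
def r₂ (μ σ ρ : ℝ) : ℝ := (μ + √(μ ^ 2 + 2 * σ ^ 2 * ρ)) / σ ^ 2

/-- The dividend threshold of the model without capital issuance. -/
def u₀ (μ σ ρ : ℝ) : ℝ :=
  1 / (r₁ μ σ ρ + r₂ μ σ ρ) *
    Real.log ((ρ + μ * r₂ μ σ ρ) / (ρ - μ * r₁ μ σ ρ))

/-- The solution on the whole line of `(A - ρ) V₀ = 0`, `V₀ 0 = 0`, `V₀' u₀ = 1`, `V₀ u₀ = μ / ρ`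
(see `V₀_spec`). -/
def V₀ (μ σ ρ : ℝ) (x : ℝ) : ℝ :=
  (Real.exp (r₁ μ σ ρ * x) - Real.exp (-(r₂ μ σ ρ) * x)) /
    (r₁ μ σ ρ * Real.exp (r₁ μ σ ρ * u₀ μ σ ρ) +
      r₂ μ σ ρ * Real.exp (-(r₂ μ σ ρ) * u₀ μ σ ρ))

theorem V₀_spec {μ σ ρ : ℝ} (hμ : 0 < μ) (hσ : 0 < σ) (hρ : 0 < ρ) :
    0 < u₀ μ σ ρ ∧ (∀ x, gen μ σ (V₀ μ σ ρ) x - ρ * V₀ μ σ ρ x = 0) ∧ V₀ μ σ ρ 0 = 0 ∧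
      V₀ μ σ ρ (u₀ μ σ ρ) = μ / ρ ∧ deriv (V₀ μ σ ρ) (u₀ μ σ ρ) = 1 := by
  have hS0 : 0 ≤ μ ^ 2 + 2 * σ ^ 2 * ρ := by positivity
  have hS2 : √(μ ^ 2 + 2 * σ ^ 2 * ρ) ^ 2 = μ ^ 2 + 2 * σ ^ 2 * ρ := Real.sq_sqrt hS0
  have hSμ : μ < √(μ ^ 2 + 2 * σ ^ 2 * ρ) := by
    apply Real.lt_sqrt_of_sq_lt
    have : 0 < 2 * σ ^ 2 * ρ := by positivity
    linarith
  have e1 : σ ^ 2 / 2 * r₁ μ σ ρ ^ 2 + μ * r₁ μ σ ρ - ρ = 0 := by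
    unfold r₁
    generalize √(μ ^ 2 + 2 * σ ^ 2 * ρ) = S at hS2
    field_simp
    linear_combination hS2
  have e2 : σ ^ 2 / 2 * r₂ μ σ ρ ^ 2 - μ * r₂ μ σ ρ - ρ = 0 := by
    unfold r₂
    generalize √(μ ^ 2 + 2 * σ ^ 2 * ρ) = S at hS2
    field_simp
    linear_combination hS2
  have p1 : 0 < r₁ μ σ ρ := by unfold r₁; apply div_pos <;> [linarith; positivity]
  have p12 : r₁ μ σ ρ < r₂ μ σ ρ := by
    unfold r₁ r₂; apply div_lt_div_of_pos_right <;> [linarith; positivity]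
  have hu : (r₁ μ σ ρ + r₂ μ σ ρ) * u₀ μ σ ρ =
      Real.log (r₂ μ σ ρ ^ 2 / r₁ μ σ ρ ^ 2) := by
    have a1 : ρ + μ * r₂ μ σ ρ = σ ^ 2 / 2 * r₂ μ σ ρ ^ 2 := by linarith
    have a2 : ρ - μ * r₁ μ σ ρ = σ ^ 2 / 2 * r₁ μ σ ρ ^ 2 := by linarith
    have hne : r₁ μ σ ρ + r₂ μ σ ρ ≠ 0 := by linarith
    unfold u₀
    rw [a1, a2, mul_div_mul_left _ _ (by positivity), ← mul_assoc, mul_one_div_cancel hne, one_mul]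
  have hV : ∀ x, HasDerivAt (V₀ μ σ ρ)
      ((r₁ μ σ ρ * Real.exp (r₁ μ σ ρ * x) + r₂ μ σ ρ * Real.exp (-(r₂ μ σ ρ) * x)) /
        (r₁ μ σ ρ * Real.exp (r₁ μ σ ρ * u₀ μ σ ρ) +
          r₂ μ σ ρ * Real.exp (-(r₂ μ σ ρ) * u₀ μ σ ρ))) x := by
    intro x
    have h1 := ((hasDerivAt_id x).const_mul (r₁ μ σ ρ)).exp
    have h2 := ((hasDerivAt_id x).const_mul (-(r₂ μ σ ρ))).exp
    refine ((h1.sub h2).div_const _).congr_deriv ?_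
    simp only [id]; ring
  have hdV := funext fun x => (hV x).deriv
  have hVV : ∀ x, HasDerivAt (deriv (V₀ μ σ ρ))
      ((r₁ μ σ ρ ^ 2 * Real.exp (r₁ μ σ ρ * x) -
          r₂ μ σ ρ ^ 2 * Real.exp (-(r₂ μ σ ρ) * x)) /
        (r₁ μ σ ρ * Real.exp (r₁ μ σ ρ * u₀ μ σ ρ) +
          r₂ μ σ ρ * Real.exp (-(r₂ μ σ ρ) * u₀ μ σ ρ))) x := by
    intro x
    rw [hdV]
    have h1 := (((hasDerivAt_id x).const_mul (r₁ μ σ ρ)).exp).const_mul (r₁ μ σ ρ)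
    have h2 := (((hasDerivAt_id x).const_mul (-(r₂ μ σ ρ))).exp).const_mul (r₂ μ σ ρ)
    refine ((h1.add h2).div_const _).congr_deriv ?_
    simp only [id]; ring
  have p2 : 0 < r₂ μ σ ρ := p1.trans p12
  have hD : 0 < r₁ μ σ ρ * Real.exp (r₁ μ σ ρ * u₀ μ σ ρ) +
      r₂ μ σ ρ * Real.exp (-(r₂ μ σ ρ) * u₀ μ σ ρ) := by positivity
  have ode : ∀ x, gen μ σ (V₀ μ σ ρ) x - ρ * V₀ μ σ ρ x = 0 := by
    intro x
    unfold gen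
    rw [(hVV x).deriv, (hV x).deriv, V₀]
    rw [neg_mul, mul_comm (r₂ μ σ ρ) x]
    field_simp
    linear_combination 2 * Real.exp (r₁ μ σ ρ * x) * e1 -
      2 * Real.exp (-(x * r₂ μ σ ρ)) * e2
  have d1 : deriv (V₀ μ σ ρ) (u₀ μ σ ρ) = 1 := by
    rw [(hV _).deriv]; exact div_self hD.ne'
  have d2 : deriv (deriv (V₀ μ σ ρ)) (u₀ μ σ ρ) = 0 := by
    have hx : Real.exp (r₁ μ σ ρ * u₀ μ σ ρ) =
        r₂ μ σ ρ ^ 2 / r₁ μ σ ρ ^ 2 * Real.exp (-(r₂ μ σ ρ) * u₀ μ σ ρ) := by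
      rw [← Real.exp_log (show 0 < r₂ μ σ ρ ^ 2 / r₁ μ σ ρ ^ 2 by positivity), ← hu,
        ← Real.exp_add]
      congr 1; ring
    rw [(hVV _).deriv, hx, div_eq_zero_iff]
    left; field_simp; ring
  refine ⟨?_, ode, by simp [V₀], ?_, d1⟩
  · have : 0 < Real.log (r₂ μ σ ρ ^ 2 / r₁ μ σ ρ ^ 2) := by
      apply Real.log_pos
      rw [one_lt_div (by positivity)]
      exact pow_lt_pow_left₀ p12 p1.le two_ne_zero
    rw [← hu] at this
    exact (mul_pos_iff_of_pos_left (by linarith)).1 this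
  · have := ode (u₀ μ σ ρ)
    unfold gen at this
    rw [d1, d2] at this
    field_simp
    linarith

/-- The number `û_K`: the unique solution `z` of `V₀ z = z + μ / ρ - K - u₀`. -/
def uHat (μ σ ρ K : ℝ) : ℝ :=
  Classical.epsilon fun z : ℝ => V₀ μ σ ρ z = z + μ / ρ - K - u₀ μ σ ρ

/-! ### The functions `p` and `h` -/

variable {Ω : Type*} [MeasurableSpace Ω]

/-- The first time at which `X(s) = x + μ s + σ W(s)` is `0` (`∞` if there is none). -/
def hitTime (W : ℝ≥0 → Ω → ℝ) (μ σ x : ℝ) (ω : Ω) : ℝ≥0∞ :=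
  ⨅ (s : ℝ≥0) (_ : x + μ * s + σ * W s ω = 0), (s : ℝ≥0∞)

/-- `p x t = P(τ_x < t)`. -/
def p (P : Measure Ω) (W : ℝ≥0 → Ω → ℝ) (μ σ x t : ℝ) : ℝ :=
  P.real {ω | hitTime W μ σ x ω < ENNReal.ofReal t}

/-- `h` is a classical solution of `∂h/∂t = A h` for `x, t > 0` with `h(0,t) = 0` and
`h(x,0) = x`, continuous up to the boundary and of at most linear growth in `x`, uniformly on
bounded time intervals. There is exactly one such function on `x, t ≥ 0`. -/
structure IsDirichletSolution (μ σ : ℝ) (h : ℝ → ℝ → ℝ) : Prop where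
  cont : ContinuousOn (fun q : ℝ × ℝ => h q.1 q.2) (Set.Ici 0 ×ˢ Set.Ici 0)
  diff_t : ∀ x > 0, ∀ t > 0, DifferentiableAt ℝ (fun s => h x s) t
  diff_x : ∀ x > 0, ∀ t > 0, DifferentiableAt ℝ (fun y => h y t) x
  diff_xx : ∀ x > 0, ∀ t > 0, DifferentiableAt ℝ (deriv fun y => h y t) x
  eqn : ∀ x > 0, ∀ t > 0, deriv (fun s => h x s) t = gen μ σ (fun y => h y t) x
  boundary : ∀ t > 0, h 0 t = 0
  initial : ∀ x > 0, h x 0 = x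
  growth : ∀ T > 0, ∃ C, ∀ x ≥ 0, ∀ t, 0 ≤ t → t ≤ T → |h x t| ≤ C * (1 + x)

/-- The solution of the Dirichlet problem (its values are only used for `x ≥ 0`, `t > 0`). -/
def h (μ σ : ℝ) : ℝ → ℝ → ℝ := Classical.epsilon (IsDirichletSolution μ σ)

/-! ### The thresholds -/

/-- `β(t) = (∂h/∂x(0,t) - e^{ρt} V₀'(0)) / ∂p/∂x(0,t)`; the `x`-derivatives at the boundary
point `x = 0` of the half line are one-sided. -/
def betaCrit (P : Measure Ω) (W : ℝ≥0 → Ω → ℝ) (μ σ ρ t : ℝ) : ℝ :=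
  (derivWithin (fun x => h μ σ x t) (Set.Ici 0) 0 -
      Real.exp (ρ * t) * deriv (V₀ μ σ ρ) 0) /
    derivWithin (fun x => p P W μ σ x t) (Set.Ici 0) 0

open Classical in
/-- `u₂(β,t)`: equal to `u₀` if `β ≤ β(t)`, and otherwise the supremum of all real `z` with
`β (1 - p(x,t)) + h(x,t) ≤ e^{ρt} V₀(x - z + u₀)` for all `x ≥ 0`. -/
def u₂ (P : Measure Ω) (W : ℝ≥0 → Ω → ℝ) (μ σ ρ β t : ℝ) : ℝ :=
  if β ≤ betaCrit P W μ σ ρ t then u₀ μ σ ρ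
  else sSup {z : ℝ | ∀ x ≥ 0, β * (1 - p P W μ σ x t) + h μ σ x t ≤
    Real.exp (ρ * t) * V₀ μ σ ρ (x - z + u₀ μ σ ρ)}

/-- `u₁(β,t)` for `β > β(t)`: the point `x > 0` at which the inequality defining `u₂(β,t)` is an
equality for `z = u₂(β,t)`. -/
def u₁ (P : Measure Ω) (W : ℝ≥0 → Ω → ℝ) (μ σ ρ β t : ℝ) : ℝ :=
  Classical.epsilon fun x : ℝ => 0 < x ∧ β * (1 - p P W μ σ x t) + h μ σ x t =
    Real.exp (ρ * t) * V₀ μ σ ρ (x - u₂ P W μ σ ρ β t + u₀ μ σ ρ)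

/-- The solution `β > β(Δ)` of `β + u₂(β,Δ) = μ / ρ - K`, for `K < μ / ρ - u₀ - β(Δ)`. -/
def betaK (P : Measure Ω) (W : ℝ≥0 → Ω → ℝ) (μ σ ρ K Δ : ℝ) : ℝ :=
  Classical.epsilon fun β : ℝ =>
    betaCrit P W μ σ ρ Δ < β ∧ β + u₂ P W μ σ ρ β Δ = μ / ρ - K

open Classical in
/-- The threshold `u_{1,K}(Δ)` below which capital is raised. -/
def u₁K (P : Measure Ω) (W : ℝ≥0 → Ω → ℝ) (μ σ ρ K Δ : ℝ) : ℝ :=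
  if K < μ / ρ - u₀ μ σ ρ - betaCrit P W μ σ ρ Δ
  then u₁ P W μ σ ρ (betaK P W μ σ ρ K Δ) Δ else 0

open Classical in
/-- The threshold `u_{2,K}(Δ)` above which dividends are paid. -/
def u₂K (P : Measure Ω) (W : ℝ≥0 → Ω → ℝ) (μ σ ρ K Δ : ℝ) : ℝ :=
  if K < μ / ρ - u₀ μ σ ρ - betaCrit P W μ σ ρ Δ
  then u₂ P W μ σ ρ (betaK P W μ σ ρ K Δ) Δ else u₀ μ σ ρ

end BankModel

end

/-! Write v = û_K, B = V₀(v), L = σ√Δ|ln Δ|^{1/2} and β = B - l. By the equation for û_K, β + u₂ =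
μ/ρ - K is the same as u₂ = u₀ - v + l. Everything thus rests on the number l for which (B - l)(1 -
p(x,Δ)) + h(x,Δ) ≤ e^{ρΔ} V₀(v + x - l), x ≥ 0, just holds, and on the point of contact x = u₁.

Up to errors O(√Δ) = o(L), h(x,Δ) is x and the factor e^{ρΔ} is 1. At x = ξL the probability p is
Δ^{ξ²/2} up to logarithmic factors, while L is Δ^{1/2} up to such a factor. If ξ < 1, then p
dominates L and the loss Bp makes the inequality hold with room to spare. If ξ ≥ 1, then p is
negligible against L and the inequality reads B + (x - l) ≤ V₀(v + x - l); since V₀' > 1 near v <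
u₀, this means x ≥ l to leading order. Hence the critical l is asymptotic to L, and so is the point
of contact.

The room off the scale is `eventually_gap`. The bounds `eventually_csSup_feasible_le` and
`eventually_le_csSup_feasible`, with the monotonicity in `strictMono_add_csSup_feasible`, trap l
between (1 - ε)L and (1 + ε)L; `exists_eq_of_gap` supplies the contact. By `tendsto_betaCrit` small
Δ fall into the nontrivial branch of the definitions. The inputs on p are `p_le` (Lévy's inequality)
and `le_p` (the marginal at one time), so no closed formula for p is needed; the input on h is
`abs_h_sub_le`, from the method of images and the maximum principle. -/

namespace BankModel

/-! ### The standard normal distribution function -/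

/-- The standard normal density. -/
noncomputable def normalPdf (u : ℝ) : ℝ := gaussianPDFReal 0 1 u

/-- The standard normal distribution function. -/
noncomputable def normalCdf (u : ℝ) : ℝ := (gaussianReal 0 1).real (Set.Iic u)

theorem normalPdf_eq (u : ℝ) : normalPdf u = (√(2 * Real.pi))⁻¹ * Real.exp (-(u ^ 2) / 2) := by
  simp [normalPdf, gaussianPDFReal]

theorem normalPdf_pos (u : ℝ) : 0 < normalPdf u := gaussianPDFReal_pos _ _ _ one_ne_zero

theorem normalPdf_le_one (u : ℝ) : normalPdf u ≤ 1 := by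
  rw [normalPdf_eq]
  have h1 : 1 ≤ √(2 * Real.pi) := by
    rw [Real.one_le_sqrt]; nlinarith [Real.pi_gt_three]
  exact mul_le_one₀ (inv_le_one_of_one_le₀ h1) (Real.exp_pos _).le
    (Real.exp_le_one_iff.2 (by nlinarith [sq_nonneg u]))

theorem normalPdf_neg (u : ℝ) : normalPdf (-u) = normalPdf u := by simp [normalPdf_eq]

theorem normalPdf_anti {u v : ℝ} (hu : 0 ≤ u) (huv : u ≤ v) : normalPdf v ≤ normalPdf u := by
  rw [normalPdf_eq, normalPdf_eq]
  gcongr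

theorem hasDerivAt_normalPdf (u : ℝ) : HasDerivAt normalPdf (-u * normalPdf u) u := by
  have h1 : HasDerivAt (fun u : ℝ => (√(2 * Real.pi))⁻¹ * Real.exp (-(u ^ 2) / 2))
      (-u * normalPdf u) u := by
    have := ((((hasDerivAt_pow 2 u).neg).div_const 2).exp).const_mul (√(2 * Real.pi))⁻¹
    refine this.congr_deriv ?_
    rw [normalPdf_eq]; simp; ring
  exact h1.congr_of_eventuallyEq (Eventually.of_forall normalPdf_eq)

theorem continuous_normalPdf : Continuous normalPdf :=
  continuous_iff_continuousAt.2 fun u => (hasDerivAt_normalPdf u).continuousAt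

theorem normalCdf_eq_integral (u : ℝ) : normalCdf u = ∫ v in Set.Iic u, normalPdf v := by
  rw [normalCdf, Measure.real, gaussianReal_apply_eq_integral _ one_ne_zero]
  exact ENNReal.toReal_ofReal (integral_nonneg fun v => (normalPdf_pos v).le)

theorem hasDerivAt_normalCdf (u : ℝ) : HasDerivAt normalCdf (normalPdf u) u := by
  have hi : Integrable normalPdf := integrable_gaussianPDFReal 0 1
  have h1 : ∀ v, normalCdf v = normalCdf 0 + ∫ w in (0 : ℝ)..v, normalPdf w := fun v => by
    rw [← intervalIntegral.integral_Iic_sub_Iic hi.integrableOn hi.integrableOn,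
      normalCdf_eq_integral, normalCdf_eq_integral]
    ring
  have h2 : HasDerivAt (fun v => normalCdf 0 + ∫ w in (0 : ℝ)..v, normalPdf w) (normalPdf u) u :=
    (intervalIntegral.integral_hasDerivAt_right (hi.intervalIntegrable)
      (continuous_normalPdf.stronglyMeasurableAtFilter _ _)
      continuous_normalPdf.continuousAt).const_add _
  exact h2.congr_of_eventuallyEq (Eventually.of_forall h1)

theorem continuous_normalCdf : Continuous normalCdf :=
  continuous_iff_continuousAt.2 fun u => (hasDerivAt_normalCdf u).continuousAt

theorem normalCdf_nonneg (u : ℝ) : 0 ≤ normalCdf u := measureReal_nonneg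

theorem normalCdf_le_one (u : ℝ) : normalCdf u ≤ 1 := measureReal_le_one

theorem gaussianReal_real_Iio {t : ℝ≥0} (ht : t ≠ 0) (b : ℝ) :
    (gaussianReal 0 t).real (Set.Iio b) = normalCdf (b / √(t : ℝ)) := by
  have hs : 0 < √(t : ℝ) := Real.sqrt_pos.2 (by positivity)
  have := nullSingletonClass_gaussianReal (μ := 0) (one_ne_zero (α := ℝ≥0))
  have h1 : (gaussianReal 0 1).map (√(t : ℝ) * ·) = gaussianReal 0 t := by
    rw [gaussianReal_map_const_mul]
    congr 1
    · simp
    · ext; simp [Real.sq_sqrt]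
  rw [← h1, map_measureReal_apply (by fun_prop) measurableSet_Iio, normalCdf,
    measureReal_congr (Iio_ae_eq_Iic (μ := gaussianReal 0 1)).symm]
  congr 1
  ext x
  simp [lt_div_iff₀' hs]

theorem normalCdf_neg (u : ℝ) : normalCdf (-u) = 1 - normalCdf u := by
  have := nullSingletonClass_gaussianReal (μ := 0) (one_ne_zero (α := ℝ≥0))
  have h1 : (gaussianReal 0 1).map (fun x => -x) = gaussianReal 0 1 := by
    rw [gaussianReal_map_neg]; simp
  rw [normalCdf, normalCdf, ← h1, map_measureReal_apply (by fun_prop) measurableSet_Iic, h1,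
    ← probReal_compl_eq_one_sub measurableSet_Iic, Set.compl_Iic,
    measureReal_congr (Ioi_ae_eq_Ici (μ := gaussianReal 0 1))]
  congr 1
  ext x
  simp

/-- Chernoff's bound with exponent -u. -/
theorem normalCdf_neg_le_exp {u : ℝ} (hu : 0 ≤ u) : normalCdf (-u) ≤ Real.exp (-(u ^ 2) / 2) := by
  have h1 := measure_le_le_exp_mul_mgf (μ := gaussianReal 0 1) (X := id) (t := -u) (-u)
    (by linarith) (by simpa using integrable_exp_mul_gaussianReal (μ := 0) (v := 1) (-u))
  rw [mgf_id_gaussianReal] at h1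
  refine h1.trans (le_of_eq ?_)
  simp only [← Real.exp_add]
  congr 1
  simp
  ring

/-- Mean value theorem on [-(u + 1), -u]. The shift by 1 is crude but harmless, since u tends to
infinity in the application. -/
theorem normalPdf_le_normalCdf_neg {u : ℝ} (hu : 0 ≤ u) : normalPdf (u + 1) ≤ normalCdf (-u) := by
  obtain ⟨c, hc, h1⟩ := exists_hasDerivAt_eq_slope normalCdf normalPdf
    (show -(u + 1) < -u by linarith) continuous_normalCdf.continuousOn
    fun v _ => hasDerivAt_normalCdf v
  have h2 : normalPdf (u + 1) ≤ normalPdf c := by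
    rw [← normalPdf_neg c]
    exact normalPdf_anti (by linarith [hc.2]) (by linarith [hc.1])
  have h3 := normalCdf_nonneg (-(u + 1))
  have h4 : -u - -(u + 1) = 1 := by ring
  rw [h4, div_one] at h1
  linarith

/-- The mass of [-u, u] is 2u times a value of the density on [-1, 1]. This makes 1 - p grow at
least linearly at the boundary. -/
theorem normalCdf_sub_neg_ge {u : ℝ} (hu : 0 ≤ u) (hu' : u ≤ 1) :
    2 * u * normalPdf 1 ≤ 1 - 2 * normalCdf (-u) := by
  rcases hu.eq_or_lt with rfl | hu0
  · have := normalCdf_neg 0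
    simp only [neg_zero] at this ⊢
    linarith
  obtain ⟨c, hc, h1⟩ := exists_hasDerivAt_eq_slope normalCdf normalPdf
    (show -u < u by linarith) continuous_normalCdf.continuousOn
    fun v _ => hasDerivAt_normalCdf v
  have h2 : normalPdf 1 ≤ normalPdf c := by
    rcases le_total 0 c with h | h
    · exact normalPdf_anti h (by linarith [hc.2])
    · rw [← normalPdf_neg c]
      exact normalPdf_anti (by linarith) (by linarith [hc.1])
  rw [eq_div_iff (by linarith)] at h1
  have h3 := normalCdf_neg u
  nlinarith

theorem mul_normalCdf_neg_le_one {u : ℝ} (hu : 0 ≤ u) : u * normalCdf (-u) ≤ 1 := by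
  have h1 : u ≤ Real.exp (u ^ 2 / 2) := by
    nlinarith [Real.add_one_le_exp (u ^ 2 / 2), sq_nonneg (u - 1)]
  calc u * normalCdf (-u) ≤ Real.exp (u ^ 2 / 2) * Real.exp (-(u ^ 2) / 2) :=
        mul_le_mul h1 (normalCdf_neg_le_exp hu) (normalCdf_nonneg _) (Real.exp_pos _).le
    _ = 1 := by rw [← Real.exp_add]; ring_nf; exact Real.exp_zero

end BankModel

namespace BankModel

variable {Ω : Type*} [MeasurableSpace Ω] {P : Measure Ω} {W : ℝ≥0 → Ω → ℝ}

/-! ### Lévy's maximal inequality -/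

theorem half_le_gaussianReal_Iic_zero (v : ℝ≥0) : 1 ≤ 2 * gaussianReal 0 v (Set.Iic 0) := by
  have h1 : gaussianReal 0 v (Set.Ici 0) = gaussianReal 0 v (Set.Iic 0) := by
    have h2 : (gaussianReal 0 v).map (fun x => -x) = gaussianReal 0 v := by
      rw [gaussianReal_map_neg]; simp
    conv_lhs => rw [← h2, Measure.map_apply (by fun_prop) measurableSet_Ici]
    congr 1
    ext x
    simp
  calc (1 : ℝ≥0∞) = gaussianReal 0 v (Set.Iic 0 ∪ Set.Ici 0) := by simp
    _ ≤ gaussianReal 0 v (Set.Iic 0) + gaussianReal 0 v (Set.Ici 0) := measure_union_le _ _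
    _ = 2 * gaussianReal 0 v (Set.Iic 0) := by rw [h1, two_mul]

/-- **Lévy's inequality** for the minimum of a Brownian motion over finitely many times. -/
theorem measure_exists_mem_lt_le (hW : IsPreBrownianReal W P) {t : ℝ≥0} (T : Finset ℝ≥0)
    (hT : ∀ s ∈ T, s ≤ t) (a : ℝ) :
    P {ω | ∃ s ∈ T, W s ω < a} ≤ 2 * P {ω | W t ω < a} := by
  classical
  -- `A s`: s is the first time in T at which the path is below a. `D s`: the path does not rise
  -- from s to t, so that it is still below a at time t.
  set A : ℝ≥0 → Set Ω := fun s => {ω | W s ω < a ∧ ∀ r ∈ T, r < s → a ≤ W r ω} with hA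
  set D : ℝ≥0 → Set Ω := fun s => {ω | W t ω - W s ω ≤ 0} with hD
  have hlaw : ∀ s, P (D s) = gaussianReal 0 (nndist t.1 s.1) (Set.Iic 0) := fun s => by
    have h1 := hW.hasLaw_sub t s
    rw [← h1.map_eq, Measure.map_apply_of_aemeasurable h1.aemeasurable measurableSet_Iic]
    rfl
  -- The increment after s is symmetric and independent of the path up to s, so given `A s` the
  -- event `D s` has probability at least 1/2.
  have hind : ∀ s ∈ T, P (A s) ≤ 2 * P (A s ∩ D s) := by
    intro s hs
    set R : Set (Set.Iic s) := {r | r.1 ∈ T ∧ r.1 < s} with hR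
    have hRc : R.Countable :=
      (T.finite_toSet.preimage Subtype.val_injective.injOn).countable.mono fun r hr => hr.1
    have h1 := (hW.indepFun_shift s).measure_inter_preimage_eq_mul
      {f | f (t - s) ≤ 0}
      ({g | g ⟨s, Set.self_mem_Iic⟩ < a} ∩ ⋂ r ∈ R, {g | a ≤ g r})
      (measurableSet_le (measurable_pi_apply _) measurable_const)
      ((measurableSet_lt (measurable_pi_apply _) measurable_const).inter
        (MeasurableSet.biInter hRc fun r _ =>
          measurableSet_le measurable_const (measurable_pi_apply r)))
    have e1 : (fun ω u => W (s + u) ω - W s ω) ⁻¹' {f : ℝ≥0 → ℝ | f (t - s) ≤ 0} = D s := by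
      ext ω
      simp [hD, add_tsub_cancel_of_le (hT s hs)]
    have e2 : (fun ω (u : Set.Iic s) => W u ω) ⁻¹'
        ({g | g ⟨s, Set.self_mem_Iic⟩ < a} ∩ ⋂ r ∈ R, {g | a ≤ g r}) = A s := by
      ext ω
      simp only [hA, hR, Set.mem_preimage, Set.mem_inter_iff, Set.mem_iInter, Set.mem_ofPred_eq,
        Subtype.forall, Set.mem_Iic]
      exact and_congr_right fun _ => ⟨fun h r hr hrs => h r hrs.le ⟨hr, hrs⟩,
        fun h r _ hr => h r hr.1 hr.2⟩
    have h2 : P (D s ∩ A s) = P (D s) * P (A s) := by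
      rw [e1, e2] at h1
      exact h1
    rw [Set.inter_comm, h2, hlaw, ← mul_assoc]
    calc P (A s) = 1 * P (A s) := (one_mul _).symm
      _ ≤ _ := by gcongr; exact half_le_gaussianReal_Iic_zero _
  have hcover : {ω | ∃ s ∈ T, W s ω < a} ⊆ ⋃ s ∈ T, A s := by
    rintro ω ⟨s, hs, hsa⟩
    have hne : (T.filter fun r => W r ω < a).Nonempty := ⟨s, by simp [hs, hsa]⟩
    have hm := Finset.mem_filter.1 (Finset.min'_mem _ hne)
    simp only [Set.mem_iUnion]
    refine ⟨_, hm.1, hm.2, fun r hr hlt => ?_⟩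
    by_contra! hra
    exact absurd (Finset.min'_le _ r (by simp [hr, hra])) (not_le.2 hlt)
  have hmeas : ∀ s ∈ T, NullMeasurableSet (A s ∩ D s) P := by
    intro s _
    have hm : ∀ r, AEMeasurable (W r) P := hW.aemeasurable
    refine NullMeasurableSet.inter (NullMeasurableSet.inter ?_ ?_) ?_
    · exact nullMeasurableSet_lt (hm s) aemeasurable_const
    · have : {ω | ∀ r ∈ T, r < s → a ≤ W r ω} =
          ⋂ r ∈ T.filter (· < s), {ω | a ≤ W r ω} := by
        ext ω; simp
      change NullMeasurableSet {ω | ∀ r ∈ T, r < s → a ≤ W r ω} P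
      rw [this]
      exact Finset.nullMeasurableSet_biInter _ fun r _ =>
        nullMeasurableSet_le aemeasurable_const (hm r)
    · exact nullMeasurableSet_le ((hm t).sub (hm s)) aemeasurable_const
  calc P {ω | ∃ s ∈ T, W s ω < a} ≤ P (⋃ s ∈ T, A s) := measure_mono hcover
    _ ≤ ∑ s ∈ T, P (A s) := measure_biUnion_finset_le _ _
    _ ≤ ∑ s ∈ T, 2 * P (A s ∩ D s) := Finset.sum_le_sum hind
    _ = 2 * P (⋃ s ∈ T, A s ∩ D s) := by
      rw [← Finset.mul_sum, measure_biUnion_finset₀ _ hmeas]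
      intro s hs r hr hsr
      refine Disjoint.aedisjoint (Set.disjoint_left.2 ?_)
      rintro ω ⟨⟨h1, h2⟩, -⟩ ⟨⟨h3, h4⟩, -⟩
      rcases lt_or_gt_of_ne hsr with h | h
      · exact absurd (h4 s hs h) (not_le.2 h1)
      · exact absurd (h2 r hr h) (not_le.2 h3)
    _ ≤ 2 * P {ω | W t ω < a} := by
      gcongr
      refine Set.iUnion₂_subset fun s _ => ?_
      rintro ω ⟨⟨h1, -⟩, h2⟩
      simp only [hD, Set.mem_ofPred_eq] at h1 h2 ⊢
      linarith

/-- **Lévy's inequality** for the minimum of a Brownian motion over a time interval. -/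
theorem measure_exists_lt_le (hW : IsBrownianReal W P) (t : ℝ≥0) (a : ℝ) :
    P {ω | ∃ s < t, W s ω < a} ≤ 2 * P {ω | W t ω < a} := by
  classical
  set d := TopologicalSpace.denseSeq ℝ≥0
  set T : ℕ → Finset ℝ≥0 := fun n => ((Finset.range n).image d).filter (· < t) with hT
  have hmono : Monotone fun n => {ω | ∃ s ∈ T n, W s ω < a} := by
    rintro m n hmn ω ⟨s, hs, hsa⟩
    refine ⟨s, ?_, hsa⟩
    simp only [hT, Finset.mem_filter] at hs ⊢
    exact ⟨Finset.image_subset_image (Finset.range_mono hmn) hs.1, hs.2⟩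
  calc P {ω | ∃ s < t, W s ω < a} ≤ P (⋃ n, {ω | ∃ s ∈ T n, W s ω < a}) := by
        refine measure_mono_ae ?_
        filter_upwards [hW.cont] with ω hω
        rintro ⟨s, hst, hsa⟩
        -- By continuity these times form an open set, which a dense sequence must meet; so
        -- countably many times suffice.
        have ho : IsOpen {s : ℝ≥0 | s < t ∧ W s ω < a} :=
          (isOpen_lt continuous_id continuous_const).inter (isOpen_lt hω continuous_const)
        obtain ⟨n, hn⟩ := (TopologicalSpace.denseRange_denseSeq ℝ≥0).exists_mem_open ho ⟨s, hst, hsa⟩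
        refine Set.mem_iUnion.2 ⟨n + 1, d n, ?_, hn.2⟩
        simp only [hT, Finset.mem_filter, Finset.mem_image, Finset.mem_range]
        exact ⟨⟨n, Nat.lt_succ_self n, rfl⟩, hn.1⟩
    _ = ⨆ n, P {ω | ∃ s ∈ T n, W s ω < a} := hmono.measure_iUnion
    _ ≤ 2 * P {ω | W t ω < a} := iSup_le fun n =>
      measure_exists_mem_lt_le hW.toIsPreBrownianReal (T n)
        (fun s hs => (Finset.mem_filter.1 hs).2.le) a

theorem measureReal_lt_eq (hW : IsPreBrownianReal W P) {t : ℝ≥0} (ht : t ≠ 0) (a : ℝ) :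
    P.real {ω | W t ω < a} = normalCdf (a / √(t : ℝ)) := by
  have h1 := hW.hasLaw_eval t
  rw [← gaussianReal_real_Iio ht, ← h1.map_eq,
    map_measureReal_apply_of_aemeasurable h1.aemeasurable measurableSet_Iio]
  rfl

/-! ### The hitting probability -/

theorem p_eq (μ σ x t : ℝ) :
    p P W μ σ x t = P.real {ω | ∃ s : ℝ≥0, s < t.toNNReal ∧ x + μ * s + σ * W s ω = 0} := by
  unfold p hitTime
  congr 1
  ext ω
  simp only [Set.mem_ofPred_eq, iInf_lt_iff]
  constructor
  · rintro ⟨s, hs, hlt⟩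
    refine ⟨s, ?_, hs⟩
    rw [ENNReal.ofReal] at hlt
    exact_mod_cast hlt
  · rintro ⟨s, hlt, hs⟩
    refine ⟨s, hs, ?_⟩
    rw [ENNReal.ofReal]
    exact_mod_cast hlt

/-- The path `X` reaches `0` before time `t` iff it is nonpositive at some time before `t`. -/
theorem exists_eq_zero_iff {w : ℝ≥0 → ℝ} (hw : Continuous w) (h0 : w 0 = 0) {μ σ x : ℝ}
    (hx : 0 ≤ x) (t : ℝ≥0) :
    (∃ s : ℝ≥0, s < t ∧ x + μ * s + σ * w s = 0) ↔ ∃ s : ℝ≥0, s < t ∧ x + μ * s + σ * w s ≤ 0 := by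
  constructor
  · rintro ⟨s, hs, h⟩
    exact ⟨s, hs, h.le⟩
  · rintro ⟨s, hs, h⟩
    have hc : Continuous fun s : ℝ≥0 => x + μ * s + σ * w s := by fun_prop
    have h1 := intermediate_value_Icc' (zero_le (a := s)) hc.continuousOn
    obtain ⟨r, hr, hr0⟩ := h1 (show (0 : ℝ) ∈ Set.Icc _ _ from ⟨h, by simpa [h0] using hx⟩)
    exact ⟨r, hr.2.trans_lt hs, hr0⟩

/-- In this form the event visibly shrinks as x grows, and it is stable under pathwise lower bounds.
-/
theorem p_eq_nonpos (hW : IsBrownianReal W P) (μ σ : ℝ) {x t : ℝ} (hx : 0 ≤ x) :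
    p P W μ σ x t = P.real {ω | ∃ s : ℝ≥0, s < t.toNNReal ∧ x + μ * s + σ * W s ω ≤ 0} := by
  rw [p_eq]
  refine measureReal_congr ?_
  filter_upwards [hW.cont, hW.eval_zero_ae_eq_zero] with ω hω h0
  exact propext (exists_eq_zero_iff hω h0 hx _)

theorem isProbabilityMeasure_of_isBrownianReal (hW : IsBrownianReal W P) : IsProbabilityMeasure P :=
  hW.isGaussianProcess.isProbabilityMeasure

theorem p_nonneg (μ σ x t : ℝ) : 0 ≤ p P W μ σ x t := measureReal_nonneg

theorem p_le_one (hW : IsBrownianReal W P) (μ σ x t : ℝ) : p P W μ σ x t ≤ 1 := by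
  have := isProbabilityMeasure_of_isBrownianReal hW
  exact measureReal_le_one

theorem p_zero (hW : IsBrownianReal W P) (μ σ : ℝ) {t : ℝ} (ht : 0 < t) :
    p P W μ σ 0 t = 1 := by
  have := isProbabilityMeasure_of_isBrownianReal hW
  rw [p_eq, ← probReal_univ (μ := P)]
  refine measureReal_congr ?_
  filter_upwards [hW.eval_zero_ae_eq_zero] with ω h0
  refine propext (iff_of_true ⟨0, ?_, ?_⟩ trivial)
  · simpa using ht
  · simp [h0]

theorem p_antitone (hW : IsBrownianReal W P) (μ σ : ℝ) {x y t : ℝ} (hx : 0 ≤ x) (hxy : x ≤ y) :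
    p P W μ σ y t ≤ p P W μ σ x t := by
  have := isProbabilityMeasure_of_isBrownianReal hW
  rw [p_eq_nonpos hW _ _ hx, p_eq_nonpos hW _ _ (hx.trans hxy)]
  refine measureReal_mono ?_
  rintro ω ⟨s, hs, h⟩
  exact ⟨s, hs, by linarith⟩

/-- The drift only helps to avoid 0: a hit forces W below -x/σ, and Lévy's inequality applies. -/
theorem p_le (hW : IsBrownianReal W P) {μ σ x t : ℝ} (hμ : 0 < μ) (hσ : 0 < σ) (hx : 0 ≤ x)
    (ht : 0 < t) : p P W μ σ x t ≤ 2 * normalCdf (-(x / (σ * √t))) := by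
  have := isProbabilityMeasure_of_isBrownianReal hW
  rcases hx.eq_or_lt with rfl | hx0
  · have h1 := normalCdf_neg 0
    rw [p_zero hW _ _ ht]
    simp only [zero_div, neg_zero] at h1 ⊢
    linarith
  have ht' : t.toNNReal ≠ 0 := by simpa using ht
  have h1 : P {ω | ∃ s : ℝ≥0, s < t.toNNReal ∧ x + μ * s + σ * W s ω = 0} ≤
      P {ω | ∃ s < t.toNNReal, W s ω < -x / σ} := by
    refine measure_mono_ae ?_
    filter_upwards [hW.eval_zero_ae_eq_zero] with ω h0
    rintro ⟨s, hs, h⟩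
    refine ⟨s, hs, ?_⟩
    -- As x > 0 the hit is not at time 0, so the drift is strictly positive there and W lies
    -- strictly below -x/σ.
    have hs0 : 0 < (s : ℝ) := by
      rcases eq_or_ne s 0 with rfl | hne
      · simp [h0] at h
        exact absurd h hx0.ne'
      · positivity
    rw [lt_div_iff₀ hσ]
    have := mul_pos hμ hs0
    linarith
  have h2 := h1.trans (measure_exists_lt_le hW t.toNNReal (-x / σ))
  rw [p_eq]
  have h3 := measureReal_lt_eq hW.toIsPreBrownianReal ht' (-x / σ)
  rw [Real.coe_toNNReal t ht.le, div_div, neg_div (σ * √t)] at h3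
  rw [← h3]
  have h4 := ENNReal.toReal_mono (by finiteness) h2
  simpa [Measure.real, ENNReal.toReal_mul] using h4

/-- A path that is negative at time t was already negative slightly earlier, hence has hit 0
strictly before t. -/
theorem le_p (hW : IsBrownianReal W P) {μ σ x t : ℝ} (hσ : 0 < σ) (hx : 0 ≤ x)
    (ht : 0 < t) : normalCdf (-((x + μ * t) / (σ * √t))) ≤ p P W μ σ x t := by
  have := isProbabilityMeasure_of_isBrownianReal hW
  have ht' : t.toNNReal ≠ 0 := by simpa using ht
  have h3 := measureReal_lt_eq hW.toIsPreBrownianReal ht' (-(x + μ * t) / σ)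
  rw [Real.coe_toNNReal t ht.le, div_div, neg_div (σ * √t)] at h3
  rw [← h3, p_eq_nonpos hW _ _ hx]
  refine ENNReal.toReal_mono (by finiteness) (measure_mono_ae ?_)
  filter_upwards [hW.cont] with ω hω hlt
  change W t.toNNReal ω < -(x + μ * t) / σ at hlt
  rw [lt_div_iff₀ hσ] at hlt
  have ho : IsOpen {s : ℝ≥0 | x + μ * s + σ * W s ω < 0} :=
    isOpen_lt (by fun_prop) continuous_const
  have hmem : t.toNNReal ∈ {s : ℝ≥0 | x + μ * s + σ * W s ω < 0} := by
    simp only [Set.mem_ofPred_eq, Real.coe_toNNReal t ht.le]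
    linarith
  have h0 : (0 : ℝ≥0) < t.toNNReal := by simpa using ht
  obtain ⟨l, hl, hsub⟩ := exists_Ioc_subset_of_mem_nhds (ho.mem_nhds hmem) ⟨0, h0⟩
  obtain ⟨r, hr⟩ := exists_between hl
  exact ⟨r, hr.2, (hsub ⟨hr.1, hr.2.le⟩).le⟩

/-- The hitting probability leaves `1` at least linearly at the boundary. -/
theorem one_sub_p_ge (hW : IsBrownianReal W P) {μ σ x t : ℝ} (hμ : 0 < μ) (hσ : 0 < σ)
    (hx : 0 ≤ x) (ht : 0 < t) (hxt : x ≤ σ * √t) :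
    2 * normalPdf 1 / (σ * √t) * x ≤ 1 - p P W μ σ x t := by
  have hs : 0 < σ * √t := mul_pos hσ (Real.sqrt_pos.2 ht)
  have h1 := p_le hW hμ hσ hx ht
  have h2 := normalCdf_sub_neg_ge (div_nonneg hx hs.le) ((div_le_one hs).2 hxt)
  calc 2 * normalPdf 1 / (σ * √t) * x = 2 * (x / (σ * √t)) * normalPdf 1 := by ring
    _ ≤ _ := by linarith

/-! ### Continuity of the hitting probability in the starting point -/

/-- Fubini: for each fixed value of Z, the atomless X takes the required value with probability 0.
-/
theorem measure_add_eq_const_of_indepFun [IsFiniteMeasure P] {X Z : Ω → ℝ} (hXZ : IndepFun Z X P)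
    (hX : AEMeasurable X P) (hZ : AEMeasurable Z P) [NullSingletonClass (P.map X)] (c : ℝ) :
    P {ω | X ω + Z ω = c} = 0 := by
  have hm : MeasurableSet {q : ℝ × ℝ | q.2 + q.1 = c} :=
    measurableSet_eq_fun (by fun_prop) measurable_const
  have h1 : P {ω | X ω + Z ω = c} = (P.map fun ω => (Z ω, X ω)) {q : ℝ × ℝ | q.2 + q.1 = c} := by
    rw [Measure.map_apply_of_aemeasurable (hZ.prodMk hX) hm]
    rfl
  rw [h1, (indepFun_iff_map_prod_eq_prod_map_map hZ hX).1 hXZ, Measure.measure_prod_null hm]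
  refine Eventually.of_forall fun z => ?_
  have : Prod.mk z ⁻¹' {q : ℝ × ℝ | q.2 + q.1 = c} = {c - z} := by
    ext y
    simp [eq_sub_iff_add_eq]
  change P.map X (Prod.mk z ⁻¹' {q : ℝ × ℝ | q.2 + q.1 = c}) = 0
  rw [this]
  exact measure_singleton _

/-- The minimum of a Brownian motion with drift over `[r, t)`, `r > 0`, has no atoms. -/
theorem measure_min_eq_zero (hW : IsBrownianReal W P) {μ σ : ℝ} (hσ : 0 < σ) {r t : ℝ≥0}
    (hr : r ≠ 0) (x : ℝ) :
    P {ω | (∃ s, r ≤ s ∧ s < t ∧ x + μ * s + σ * W s ω = 0) ∧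
      ∀ s, r ≤ s → s < t → 0 ≤ x + μ * s + σ * W s ω} = 0 := by
  have := isProbabilityMeasure_of_isBrownianReal hW
  rcases le_or_gt t r with htr | hrt
  · convert measure_empty (μ := P)
    ext ω
    simp only [Set.mem_ofPred_eq, Set.mem_empty_iff_false, iff_false, not_and]
    rintro ⟨s, h1, h2, -⟩
    exact absurd (h1.trans_lt h2) (not_lt.2 htr)
  set d := TopologicalSpace.denseSeq ℝ≥0 with hd
  -- The minimum over [r, t) is, after division by σ and up to a constant, `W r` plus a functional J
  -- of the increments after r. These are independent of `W r`, which has no atoms because r > 0.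
  set J : (ℝ≥0 → ℝ) → ℝ := fun f => ⨅ n : {n : ℕ // r + d n < t}, (μ / σ * d n.1 + f (d n.1))
    with hJ
  have hJm : Measurable J := Measurable.iInf fun n => (measurable_pi_apply _).const_add _
  have hlaw := hW.hasLaw_eval r
  have hNA : NullSingletonClass (P.map (W r)) := by
    rw [hlaw.map_eq]; exact nullSingletonClass_gaussianReal hr
  have hind : IndepFun (fun ω => J fun u => W (r + u) ω - W r ω) (W r) P :=
    (hW.indepFun_shift r).comp hJm (measurable_pi_apply (⟨r, Set.self_mem_Iic⟩ : Set.Iic r))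
  have hJae : AEMeasurable (fun ω => J fun u => W (r + u) ω - W r ω) P :=
    AEMeasurable.iInf fun n => ((hW.aemeasurable _).sub (hW.aemeasurable _)).const_add _
  have hne : Nonempty {n : ℕ // r + d n < t} := by
    have ho : IsOpen {u : ℝ≥0 | r + u < t} := isOpen_lt (by fun_prop) continuous_const
    obtain ⟨n, hn⟩ := (TopologicalSpace.denseRange_denseSeq ℝ≥0).exists_mem_open ho
      ⟨0, by simpa using hrt⟩
    exact ⟨n, hn⟩
  refine measure_mono_null_ae ?_
    (measure_add_eq_const_of_indepFun hind (hW.aemeasurable r) hJae (-(x + μ * r) / σ))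
  filter_upwards [hW.cont] with ω hω
  rintro ⟨⟨s, hrs, hst, hs0⟩, hpos⟩
  change W r ω + (⨅ n : {n : ℕ // r + d n < t}, (μ / σ * d n.1 + (W (r + d n.1) ω - W r ω))) =
    -(x + μ * r) / σ
  have hval : ∀ u : ℝ≥0, μ / σ * u + (W (r + u) ω - W r ω) =
      (x + μ * (r + u : ℝ≥0) + σ * W (r + u) ω) / σ + (-(x + μ * r) / σ - W r ω) := fun u => by
    push_cast
    field_simp
    ring
  have hge : ∀ n : {n : ℕ // r + d n < t}, -(x + μ * r) / σ - W r ω ≤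
      μ / σ * d n.1 + (W (r + d n.1) ω - W r ω) := fun n => by
    rw [hval]
    have := div_nonneg (hpos (r + d n.1) le_self_add n.2) hσ.le
    linarith
  have h1 : (⨅ n : {n : ℕ // r + d n < t}, (μ / σ * d n.1 + (W (r + d n.1) ω - W r ω))) =
      -(x + μ * r) / σ - W r ω := by
    refine ciInf_eq_of_forall_ge_of_forall_gt_exists_lt hge fun b hb => ?_
    have hc : Continuous fun u : ℝ≥0 => μ / σ * (u : ℝ) + (W (r + u) ω - W r ω) := by fun_prop
    have ho : IsOpen {u : ℝ≥0 | r + u < t ∧ μ / σ * u + (W (r + u) ω - W r ω) < b} :=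
      (isOpen_lt (by fun_prop) continuous_const).inter (isOpen_lt hc continuous_const)
    obtain ⟨n, hn⟩ := (TopologicalSpace.denseRange_denseSeq ℝ≥0).exists_mem_open ho
      ⟨s - r, by
        have hsr : r + (s - r) = s := add_tsub_cancel_of_le hrs
        refine ⟨by rwa [hsr], ?_⟩
        rw [hval, hsr, hs0]
        simpa using hb⟩
    exact ⟨⟨n, hn.1⟩, hn.2⟩
  rw [h1]
  ring

/-- The hitting probability is right-continuous in the starting point `x > 0`. -/
theorem exists_gt_lt_p (hW : IsBrownianReal W P) {μ σ x t c : ℝ} (hσ : 0 < σ) (hx : 0 < x)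
    (hc : c < p P W μ σ x t) : ∃ y > x, c < p P W μ σ y t := by
  have := isProbabilityMeasure_of_isBrownianReal hW
  set T := t.toNNReal
  set d := TopologicalSpace.denseSeq ℝ≥0 with hd
  set E : ℝ → Set Ω := fun y => {ω | ∃ s : ℝ≥0, s < T ∧ y + μ * s + σ * W s ω ≤ 0} with hE
  set N : ℝ≥0 → Set Ω := fun r => {ω | (∃ s, r ≤ s ∧ s < T ∧ x + μ * s + σ * W s ω = 0) ∧
      ∀ s, r ≤ s → s < T → 0 ≤ x + μ * s + σ * W s ω} with hN
  have hmono : Monotone fun n : ℕ => E (x + 1 / ((n : ℝ) + 1)) := by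
    rintro m n hmn ω ⟨s, hs, h⟩
    refine ⟨s, hs, ?_⟩
    have : 1 / ((n : ℝ) + 1) ≤ 1 / ((m : ℝ) + 1) := Nat.one_div_le_one_div hmn
    linarith
  have hnull : P (⋃ n : {n : ℕ // d n ≠ 0}, N (d n)) = 0 :=
    measure_iUnion_null fun n => measure_min_eq_zero hW hσ n.2 x
  have hle : P (E x) ≤ ⨆ n : ℕ, P (E (x + 1 / ((n : ℝ) + 1))) := by
    rw [← hmono.measure_iUnion]
    -- A path that becomes negative still does so from a slightly higher start. One that only
    -- touches 0 has minimum exactly 0 on [r, T) for some r > 0 in the dense sequence, a null event.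
    calc P (E x) ≤ P ((⋃ n : ℕ, E (x + 1 / ((n : ℝ) + 1))) ∪ ⋃ n : {n : ℕ // d n ≠ 0}, N (d n)) := by
          refine measure_mono_ae ?_
          filter_upwards [hW.cont, hW.eval_zero_ae_eq_zero] with ω hω h0
          intro hωE
          by_cases hlt : ∃ s : ℝ≥0, s < T ∧ x + μ * s + σ * W s ω < 0
          · obtain ⟨s, hs, hneg⟩ := hlt
            obtain ⟨n, hn⟩ := exists_nat_one_div_lt (neg_pos.2 hneg)
            exact Or.inl (Set.mem_iUnion.2 ⟨n, s, hs, by linarith⟩)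
          · push Not at hlt
            obtain ⟨s, hs, hle⟩ := hωE
            have hs0 : 0 < s := by
              rw [pos_iff_ne_zero]
              rintro rfl
              simp [h0] at hle
              linarith
            obtain ⟨n, hn⟩ := (TopologicalSpace.denseRange_denseSeq ℝ≥0).exists_mem_open
              (isOpen_Ioo (a := 0) (b := s)) (Set.nonempty_Ioo.2 hs0)
            exact Or.inr (Set.mem_iUnion.2 ⟨⟨n, hn.1.ne'⟩,
              ⟨s, hn.2.le, hs, le_antisymm hle (hlt s hs)⟩, fun u _ hu => hlt u hu⟩)
      _ ≤ P (⋃ n : ℕ, E (x + 1 / ((n : ℝ) + 1))) + P (⋃ n : {n : ℕ // d n ≠ 0}, N (d n)) :=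
        measure_union_le _ _
      _ = _ := by rw [hnull, add_zero]
  rw [p_eq_nonpos hW _ _ hx.le] at hc
  have hc' : ENNReal.ofReal c < P (E x) ∨ c < 0 := by
    rcases lt_or_ge c 0 with h | h
    · exact Or.inr h
    · exact Or.inl ((ENNReal.ofReal_lt_iff_lt_toReal h (by finiteness)).2 hc)
  rcases hc' with h | h
  · obtain ⟨n, hn⟩ := lt_iSup_iff.1 (h.trans_le hle)
    have hpos : (0 : ℝ) < 1 / ((n : ℝ) + 1) := Nat.one_div_pos_of_nat
    refine ⟨x + 1 / ((n : ℝ) + 1), by linarith, ?_⟩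
    rw [p_eq_nonpos hW _ _ (by linarith)]
    exact (ENNReal.lt_ofReal_iff_toReal_lt (by finiteness)).1 
      (hn.trans_eq (ENNReal.ofReal_toReal (by finiteness)).symm) |>.trans_le' (by
        simp [ENNReal.toReal_ofReal'])
  · exact ⟨x + 1, by linarith, h.trans_le (p_nonneg _ _ _ _)⟩

/-- For a nonincreasing function, right-continuity is enough. Lower semicontinuity is all that the
compactness argument in `exists_eq_of_gap` uses. -/
theorem lowerSemicontinuousOn_p (hW : IsBrownianReal W P) {μ σ t : ℝ} (hσ : 0 < σ) :
    LowerSemicontinuousOn (fun x => p P W μ σ x t) (Set.Ioi 0) := by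
  intro x hx c hc
  obtain ⟨y, hy, hcy⟩ := exists_gt_lt_p hW hσ hx hc
  filter_upwards [self_mem_nhdsWithin, nhdsWithin_le_nhds (Iio_mem_nhds hy)] with z hz hzy
  exact hcy.trans_le (p_antitone hW μ σ (le_of_lt hz) (le_of_lt hzy))

end BankModel

namespace BankModel

/-! ### The maximum principle on the half line -/

/-- The second derivative of a function is nonpositive at a local maximum. -/
theorem deriv_deriv_nonpos_of_isLocalMax {f : ℝ → ℝ} {x : ℝ} (hf : IsLocalMax f x)
    (hc : ContinuousAt f x) : deriv (deriv f) x ≤ 0 := by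
  by_contra! hpos
  -- The second derivative test would make x a local minimum as well, so f would be locally
  -- constant.
  have h1 := isLocalMin_of_deriv_deriv_pos hpos hf.deriv_eq_zero hc
  have h2 : f =ᶠ[𝓝 x] fun _ => f x := by
    filter_upwards [hf, h1] with y hy hy' using le_antisymm hy hy'
  have h3 : deriv (deriv f) x = 0 := by
    rw [h2.deriv.deriv_eq]
    simp
  linarith

/-- A subsolution of linear growth of `∂w/∂t = A w` on the quarter plane which is nonpositive on
the parabolic boundary is nonpositive. -/
theorem nonpos_of_subsolution {μ σ : ℝ} (hμ : 0 < μ) {w : ℝ → ℝ → ℝ} {T C : ℝ}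
    (cont : ContinuousOn (fun q : ℝ × ℝ => w q.1 q.2) (Set.Ici 0 ×ˢ Set.Ici 0))
    (diff_t : ∀ x > 0, ∀ t > 0, DifferentiableAt ℝ (fun s => w x s) t)
    (diff_x : ∀ x > 0, ∀ t > 0, DifferentiableAt ℝ (fun y => w y t) x)
    (diff_xx : ∀ x > 0, ∀ t > 0, DifferentiableAt ℝ (deriv fun y => w y t) x)
    (eqn : ∀ x > 0, ∀ t > 0, deriv (fun s => w x s) t ≤ gen μ σ (fun y => w y t) x)
    (boundary : ∀ t > 0, w 0 t ≤ 0) (initial : ∀ x ≥ 0, w x 0 ≤ 0)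
    (growth : ∀ x ≥ 0, ∀ t, 0 ≤ t → t ≤ T → w x t ≤ C * (1 + x)) :
    ∀ x ≥ 0, ∀ t, 0 ≤ t → t ≤ T → w x t ≤ 0 := by
  -- With this rate the barrier ε(1 + x)² e^{lt} is a strict supersolution: l(1 + x)² > σ² + 2μ(1 +
  -- x) for x ≥ 0.
  set l : ℝ := σ ^ 2 + 2 * μ + 1 with hl
  have key : ∀ ε > 0, ∀ x ≥ 0, ∀ t, 0 ≤ t → t ≤ T → w x t ≤ ε * (1 + x) ^ 2 * Real.exp (l * t) := by
    intro ε hε x hx t ht htT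
    have hl0 : 0 < l := by positivity
    by_contra! hlt
    set v : ℝ × ℝ → ℝ := fun q => w q.1 q.2 - ε * (1 + q.1) ^ 2 * Real.exp (l * q.2) with hv
    -- At x = R the quadratic barrier exceeds the linear growth bound, so the positive maximum is
    -- not on that side.
    set R : ℝ := max x (|C| / ε) with hR
    have hvR : ∀ t, 0 ≤ t → t ≤ T → v (R, t) ≤ 0 := by
      intro t ht htT
      have hR0 : 0 ≤ R := hx.trans (le_max_left _ _)
      have h1 := growth R hR0 t ht htT
      have h2 : |C| ≤ ε * (1 + R) := by
        have : |C| / ε ≤ R := le_max_right _ _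
        rw [div_le_iff₀ hε] at this
        nlinarith
      have h3 : C * (1 + R) ≤ ε * (1 + R) ^ 2 := by nlinarith [le_abs_self C]
      have h4 : ε * (1 + R) ^ 2 ≤ ε * (1 + R) ^ 2 * Real.exp (l * t) :=
        le_mul_of_one_le_right (by positivity) (Real.one_le_exp (by positivity))
      simp only [hv]
      linarith
    have hcv : ContinuousOn v (Set.Icc 0 R ×ˢ Set.Icc 0 T) := by
      refine ContinuousOn.sub (cont.mono ?_) (by fun_prop)
      exact Set.prod_mono Set.Icc_subset_Ici_self Set.Icc_subset_Ici_self
    obtain ⟨⟨x₀, t₀⟩, ⟨⟨hx0, hx0R⟩, ht0, ht0T⟩, hmax⟩ :=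
      (isCompact_Icc.prod isCompact_Icc).exists_isMaxOn
        ⟨(x, t), ⟨hx, le_max_left _ _⟩, ht, htT⟩ hcv
    simp only at hx0 hx0R ht0 ht0T
    have hpos : 0 < v (x₀, t₀) := by
      refine lt_of_lt_of_le ?_ (hmax ⟨⟨hx, le_max_left _ _⟩, ht, htT⟩)
      simp only [hv]; linarith
    have ht0' : 0 < t₀ := by
      rcases ht0.eq_or_lt with h | h
      · exfalso
        rw [← h] at hpos
        simp only [hv] at hpos
        have := initial x₀ hx0
        have : 0 ≤ ε * (1 + x₀) ^ 2 * Real.exp (l * 0) := by positivity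
        linarith
      · exact h
    have hx0' : 0 < x₀ := by
      rcases hx0.eq_or_lt with h | h
      · exfalso
        rw [← h] at hpos
        simp only [hv] at hpos
        have := boundary t₀ ht0'
        have : 0 ≤ ε * (1 + (0 : ℝ)) ^ 2 * Real.exp (l * t₀) := by positivity
        linarith
      · exact h
    have hx0R' : x₀ < R := by
      rcases hx0R.eq_or_lt with h | h
      · exfalso
        rw [h] at hpos
        linarith [hvR t₀ ht0 ht0T]
      · exact h
    set b : ℝ := Real.exp (l * t₀) with hb
    have hb0 : 0 < b := Real.exp_pos _
    -- the space variable
    have hq1 : ∀ y : ℝ, HasDerivAt (fun y => ε * (1 + y) ^ 2 * b) (2 * ε * (1 + y) * b) y := by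
      intro y
      have := ((((hasDerivAt_id y).const_add 1).pow 2).const_mul ε).mul_const b
      refine this.congr_deriv ?_
      simp only [id]; push_cast; ring
    have hq2 : HasDerivAt (fun y => 2 * ε * (1 + y) * b) (2 * ε * b) x₀ := by
      have := (((hasDerivAt_id x₀).const_add 1).const_mul (2 * ε)).mul_const b
      refine this.congr_deriv ?_
      ring
    have hlocx : IsLocalMax (fun y => w y t₀ - ε * (1 + y) ^ 2 * b) x₀ := by
      filter_upwards [Ioo_mem_nhds hx0' hx0R'] with y hy
      exact hmax (show (y, t₀) ∈ _ from ⟨⟨hy.1.le, hy.2.le⟩, ht0, ht0T⟩)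
    have hd1 : ∀ y > 0, HasDerivAt (fun y => w y t₀ - ε * (1 + y) ^ 2 * b)
        (deriv (fun y => w y t₀) y - 2 * ε * (1 + y) * b) y := fun y hy =>
      (diff_x y hy t₀ ht0').hasDerivAt.sub (hq1 y)
    have hwx : deriv (fun y => w y t₀) x₀ = 2 * ε * (1 + x₀) * b := by
      have := hlocx.hasDerivAt_eq_zero (hd1 x₀ hx0')
      linarith
    have hwxx : deriv (deriv fun y => w y t₀) x₀ ≤ 2 * ε * b := by
      have h1 := deriv_deriv_nonpos_of_isLocalMax hlocx (hd1 x₀ hx0').continuousAt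
      have h2 : deriv (fun y => w y t₀ - ε * (1 + y) ^ 2 * b) =ᶠ[𝓝 x₀]
          fun y => deriv (fun y => w y t₀) y - 2 * ε * (1 + y) * b := by
        filter_upwards [lt_mem_nhds hx0'] with y hy using (hd1 y hy).deriv
      have h3 : HasDerivAt (fun y => deriv (fun y => w y t₀) y - 2 * ε * (1 + y) * b)
          (deriv (deriv fun y => w y t₀) x₀ - 2 * ε * b) x₀ :=
        (diff_xx x₀ hx0' t₀ ht0').hasDerivAt.sub hq2
      rw [h2.deriv_eq, h3.deriv] at h1
      linarith
    -- the time variable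
    have hwt : l * (ε * (1 + x₀) ^ 2 * b) ≤ deriv (fun s => w x₀ s) t₀ := by
      have hd : HasDerivAt (fun s => w x₀ s - ε * (1 + x₀) ^ 2 * Real.exp (l * s))
          (deriv (fun s => w x₀ s) t₀ - l * (ε * (1 + x₀) ^ 2 * b)) t₀ := by
        have := (((hasDerivAt_id t₀).const_mul l).exp).const_mul (ε * (1 + x₀) ^ 2)
        refine (diff_t x₀ hx0' t₀ ht0').hasDerivAt.sub (this.congr_deriv ?_)
        simp [hb]; ring
      -- Only earlier times are compared, because t₀ may be the final time T.
      have hloct : IsLocalMaxOn (fun s => w x₀ s - ε * (1 + x₀) ^ 2 * Real.exp (l * s))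
          (Set.Icc 0 t₀) t₀ := by
        refine IsMaxOn.localize fun s hs => ?_
        exact hmax (show (x₀, s) ∈ _ from ⟨⟨hx0, hx0R⟩, hs.1, hs.2.trans ht0T⟩)
      have hcone : (0 : ℝ) - t₀ ∈ posTangentConeAt (Set.Icc 0 t₀) t₀ :=
        sub_mem_posTangentConeAt_of_segment_subset
          (by rw [segment_symm, segment_eq_Icc ht0])
      have h1 := hloct.hasFDerivWithinAt_nonpos hd.hasFDerivAt.hasFDerivWithinAt hcone
      simp only [zero_sub, ContinuousLinearMap.toSpanSingleton_apply, smul_eq_mul] at h1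
      have h2 : 0 ≤ t₀ * (deriv (fun s => w x₀ s) t₀ - l * (ε * (1 + x₀) ^ 2 * b)) := by linarith
      linarith [nonneg_of_mul_nonneg_right h2 ht0']
    have h1 := eqn x₀ hx0' t₀ ht0'
    unfold gen at h1
    rw [hwx] at h1
    have h2 : σ ^ 2 / 2 * deriv (deriv fun y => w y t₀) x₀ ≤ σ ^ 2 / 2 * (2 * ε * b) :=
      mul_le_mul_of_nonneg_left hwxx (by positivity)
    have h3 : 0 < ε * b := by positivity
    have h4 : l * (ε * (1 + x₀) ^ 2 * b) ≤ (ε * b) * (σ ^ 2 + 2 * μ * (1 + x₀)) := by linarith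
    have h5 : l * (1 + x₀) ^ 2 ≤ σ ^ 2 + 2 * μ * (1 + x₀) := by
      have : (ε * b) * (l * (1 + x₀) ^ 2) ≤ (ε * b) * (σ ^ 2 + 2 * μ * (1 + x₀)) := by linarith
      exact le_of_mul_le_mul_left this h3
    rw [hl] at h5
    nlinarith [sq_nonneg σ, mul_nonneg (sq_nonneg σ) hx0, mul_nonneg hμ.le hx0,
      mul_nonneg (mul_nonneg hμ.le hx0) hx0, mul_nonneg (mul_nonneg (sq_nonneg σ) hx0) hx0]
  intro x hx t ht htT
  refine le_of_forall_pos_le_add fun δ hδ => ?_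
  have h1 := key (δ / ((1 + x) ^ 2 * Real.exp (l * t))) (by positivity) x hx t ht htT
  have h2 : δ / ((1 + x) ^ 2 * Real.exp (l * t)) * (1 + x) ^ 2 * Real.exp (l * t) = δ := by
    field_simp
  linarith

end BankModel

namespace BankModel

/-! ### The explicit solution of the Dirichlet problem -/

/-- The mean of the positive part of a normal variable with mean `a` and standard deviation
`s > 0`. -/
noncomputable def meanPosPart (a s : ℝ) : ℝ := a * normalCdf (a / s) + s * normalPdf (a / s)

/-- For u = |a|/s both signs of a give the same error s(φ(u) - uΦ(-u)), whose bracket is at most 1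
in absolute value. -/
theorem abs_meanPosPart_sub_le {a s : ℝ} (hs : 0 < s) : |meanPosPart a s - max a 0| ≤ s := by
  have key : ∀ u : ℝ, 0 ≤ u → |normalPdf u - u * normalCdf (-u)| ≤ 1 := fun u hu => by
    rw [abs_le]
    have := mul_normalCdf_neg_le_one hu
    have := mul_nonneg hu (normalCdf_nonneg (-u))
    have := normalPdf_le_one u
    have := normalPdf_pos u
    constructor <;> linarith
  set u := a / s with hu
  have ha : a = s * u := by rw [hu]; field_simp
  rcases le_total 0 a with h | h
  · have hu0 : 0 ≤ u := div_nonneg h hs.le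
    have e : meanPosPart a s - max a 0 = s * (normalPdf u - u * normalCdf (-u)) := by
      rw [max_eq_left h, meanPosPart, ← hu, normalCdf_neg, ha]; ring
    rw [e, abs_mul, abs_of_pos hs]
    exact mul_le_of_le_one_right hs.le (key u hu0)
  · have hu0 : 0 ≤ -u := neg_nonneg.2 (div_nonpos_of_nonpos_of_nonneg h hs.le)
    have e : meanPosPart a s - max a 0 = s * (normalPdf (-u) - (-u) * normalCdf (- -u)) := by
      rw [max_eq_right h, meanPosPart, ← hu, normalPdf_neg, neg_neg, ha]; ring
    rw [e, abs_mul, abs_of_pos hs]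
    exact mul_le_of_le_one_right hs.le (key (-u) hu0)

/-- The terms with the derivative of u = a/s cancel, since φ'(u) = -uφ(u) and a = su. -/
theorem hasDerivAt_meanPosPart {a s : ℝ → ℝ} {a' s' τ : ℝ} (ha : HasDerivAt a a' τ)
    (hs : HasDerivAt s s' τ) (h0 : s τ ≠ 0) :
    HasDerivAt (fun τ => meanPosPart (a τ) (s τ))
      (a' * normalCdf (a τ / s τ) + s' * normalPdf (a τ / s τ)) τ := by
  have hu : HasDerivAt (fun τ => a τ / s τ) ((a' * s τ - a τ * s') / s τ ^ 2) τ := ha.div hs h0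
  have h1 := (hasDerivAt_normalCdf (a τ / s τ)).comp τ hu
  have h2 := (hasDerivAt_normalPdf (a τ / s τ)).comp τ hu
  refine ((ha.mul h1).add (hs.mul h2)).congr_deriv ?_
  simp only [Function.comp]
  field_simp
  ring

/-- The solution of the Dirichlet problem, obtained by the method of images. -/
noncomputable def dirichletSol (μ σ x t : ℝ) : ℝ :=
  if t ≤ 0 then x else
    meanPosPart (x + μ * t) (σ * √t) -
      Real.exp (-(2 * μ / σ ^ 2) * x) * meanPosPart (μ * t - x) (σ * √t)

theorem dirichletSol_of_pos {μ σ x t : ℝ} (ht : 0 < t) :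
    dirichletSol μ σ x t = meanPosPart (x + μ * t) (σ * √t) -
      Real.exp (-(2 * μ / σ ^ 2) * x) * meanPosPart (μ * t - x) (σ * √t) := by
  rw [dirichletSol, if_neg (not_le.2 ht)]

theorem abs_dirichletSol_sub_le {μ σ x t : ℝ} (hμ : 0 < μ) (hσ : 0 < σ) (hx : 0 ≤ x)
    (ht : 0 ≤ t) : |dirichletSol μ σ x t - x| ≤ 2 * (μ * t + σ * √t) := by
  rcases ht.eq_or_lt with rfl | ht0
  · simp [dirichletSol]
  have hs : 0 < σ * √t := mul_pos hσ (Real.sqrt_pos.2 ht0)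
  have h1 := abs_le.1 (abs_meanPosPart_sub_le (a := x + μ * t) hs)
  have h2 := abs_le.1 (abs_meanPosPart_sub_le (a := μ * t - x) hs)
  have hμt : 0 ≤ μ * t := by positivity
  rw [max_eq_left (by positivity)] at h1
  have h3 : max (μ * t - x) 0 ≤ μ * t := max_le (by linarith) hμt
  have h4 : 0 ≤ max (μ * t - x) 0 := le_max_right _ _
  have h5 : |meanPosPart (μ * t - x) (σ * √t)| ≤ μ * t + σ * √t :=
    abs_le.2 ⟨by linarith, by linarith⟩
  have h6 : |Real.exp (-(2 * μ / σ ^ 2) * x) * meanPosPart (μ * t - x) (σ * √t)| ≤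
      μ * t + σ * √t := by
    rw [abs_mul, Real.abs_exp]
    refine (mul_le_of_le_one_left (abs_nonneg _) ?_).trans h5
    rw [Real.exp_le_one_iff]
    have : 0 ≤ 2 * μ / σ ^ 2 * x := by positivity
    linarith
  have h7 := abs_le.1 h6
  rw [dirichletSol_of_pos ht0, abs_le]
  constructor <;> linarith [h1.1, h1.2, h7.1, h7.2]

/-- The `x`-derivative of `dirichletSol`. -/
noncomputable def dirichletSolDeriv (μ σ x t : ℝ) : ℝ :=
  normalCdf ((x + μ * t) / (σ * √t)) + Real.exp (-(2 * μ / σ ^ 2) * x) *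
    (2 * μ / σ ^ 2 * meanPosPart (μ * t - x) (σ * √t) + normalCdf ((μ * t - x) / (σ * √t)))

theorem hasDerivAt_exp_mul (k x : ℝ) :
    HasDerivAt (fun x => Real.exp (-k * x)) (-k * Real.exp (-k * x)) x := by
  refine (((hasDerivAt_id x).const_mul (-k)).exp).congr_deriv ?_
  simp only [id]; ring

theorem hasDerivAt_dirichletSol {μ σ t : ℝ} (hσ : 0 < σ) (ht : 0 < t) (x : ℝ) :
    HasDerivAt (fun x => dirichletSol μ σ x t) (dirichletSolDeriv μ σ x t) x := by
  have hs : σ * √t ≠ 0 := (mul_pos hσ (Real.sqrt_pos.2 ht)).ne'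
  have h1 := hasDerivAt_meanPosPart ((hasDerivAt_id x).add_const (μ * t))
    (hasDerivAt_const x (σ * √t)) hs
  have h2 := hasDerivAt_meanPosPart ((hasDerivAt_id x).const_sub (μ * t))
    (hasDerivAt_const x (σ * √t)) hs
  have h3 := h1.sub ((hasDerivAt_exp_mul (2 * μ / σ ^ 2) x).mul h2)
  refine (h3.congr_deriv ?_).congr_of_eventuallyEq
    (Eventually.of_forall fun y => dirichletSol_of_pos ht)
  simp only [dirichletSolDeriv, id]
  ring

theorem hasDerivAt_dirichletSolDeriv {μ σ t : ℝ} (hσ : 0 < σ) (ht : 0 < t) (x : ℝ) :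
    HasDerivAt (fun x => dirichletSolDeriv μ σ x t)
      (normalPdf ((x + μ * t) / (σ * √t)) / (σ * √t) - Real.exp (-(2 * μ / σ ^ 2) * x) *
        ((2 * μ / σ ^ 2) ^ 2 * meanPosPart (μ * t - x) (σ * √t) +
          2 * (2 * μ / σ ^ 2) * normalCdf ((μ * t - x) / (σ * √t)) +
          normalPdf ((μ * t - x) / (σ * √t)) / (σ * √t))) x := by
  have hs : σ * √t ≠ 0 := (mul_pos hσ (Real.sqrt_pos.2 ht)).ne'
  have h1 := (hasDerivAt_normalCdf ((x + μ * t) / (σ * √t))).comp x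
    (((hasDerivAt_id x).add_const (μ * t)).div_const (σ * √t))
  have h2 := (hasDerivAt_normalCdf ((μ * t - x) / (σ * √t))).comp x
    (((hasDerivAt_id x).const_sub (μ * t)).div_const (σ * √t))
  have h3 := hasDerivAt_meanPosPart ((hasDerivAt_id x).const_sub (μ * t))
    (hasDerivAt_const x (σ * √t)) hs
  refine (h1.add ((hasDerivAt_exp_mul (2 * μ / σ ^ 2) x).mul
    ((h3.const_mul (2 * μ / σ ^ 2)).add h2))).congr_deriv ?_
  simp only [id, Function.comp, Pi.add_apply]
  ring

theorem hasDerivAt_dirichletSol_time {μ σ t : ℝ} (hσ : 0 < σ) (ht : 0 < t) (x : ℝ) :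
    HasDerivAt (fun t => dirichletSol μ σ x t)
      (μ * normalCdf ((x + μ * t) / (σ * √t)) +
        σ ^ 2 / 2 * (normalPdf ((x + μ * t) / (σ * √t)) / (σ * √t)) -
        Real.exp (-(2 * μ / σ ^ 2) * x) * (μ * normalCdf ((μ * t - x) / (σ * √t)) +
          σ ^ 2 / 2 * (normalPdf ((μ * t - x) / (σ * √t)) / (σ * √t)))) t := by
  have hq : 0 < √t := Real.sqrt_pos.2 ht
  have hs : σ * √t ≠ 0 := (mul_pos hσ hq).ne'
  have hd := (Real.hasDerivAt_sqrt ht.ne').const_mul σ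
  have h1 := hasDerivAt_meanPosPart (((hasDerivAt_id t).const_mul μ).const_add x) hd hs
  have h2 := hasDerivAt_meanPosPart (((hasDerivAt_id t).const_mul μ).sub_const x) hd hs
  have h3 := h1.sub (h2.const_mul (Real.exp (-(2 * μ / σ ^ 2) * x)))
  refine (h3.congr_deriv ?_).congr_of_eventuallyEq ?_
  · simp only [id]
    field_simp
  · filter_upwards [lt_mem_nhds ht] with s hs using dirichletSol_of_pos hs

theorem dirichletSol_zero {μ σ t : ℝ} (ht : 0 ≤ t) : dirichletSol μ σ 0 t = 0 := by
  rcases ht.eq_or_lt with rfl | h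
  · simp [dirichletSol]
  · simp [dirichletSol_of_pos h]

theorem isDirichletSolution_dirichletSol {μ σ : ℝ} (hμ : 0 < μ) (hσ : 0 < σ) :
    IsDirichletSolution μ σ (dirichletSol μ σ) where
  cont := by
    rintro ⟨x, t⟩ ⟨hx, ht⟩
    rcases (show 0 ≤ t from ht).eq_or_lt with h | h
    · subst h
      have h1 : Tendsto (fun q : ℝ × ℝ => q.1 - 2 * (μ * q.2 + σ * √q.2))
          (𝓝[Set.Ici 0 ×ˢ Set.Ici 0] (x, 0)) (𝓝 x) := by
        have : Continuous fun q : ℝ × ℝ => q.1 - 2 * (μ * q.2 + σ * √q.2) := by fun_prop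
        simpa using (this.tendsto (x, 0)).mono_left nhdsWithin_le_nhds
      have h2 : Tendsto (fun q : ℝ × ℝ => q.1 + 2 * (μ * q.2 + σ * √q.2))
          (𝓝[Set.Ici 0 ×ˢ Set.Ici 0] (x, 0)) (𝓝 x) := by
        have : Continuous fun q : ℝ × ℝ => q.1 + 2 * (μ * q.2 + σ * √q.2) := by fun_prop
        simpa using (this.tendsto (x, 0)).mono_left nhdsWithin_le_nhds
      have h3 : dirichletSol μ σ x 0 = x := by simp [dirichletSol]
      unfold ContinuousWithinAt
      simp only [h3]
      refine tendsto_of_tendsto_of_tendsto_of_le_of_le' h1 h2 ?_ ?_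
      · filter_upwards [self_mem_nhdsWithin] with q hq
        linarith [(abs_le.1 (abs_dirichletSol_sub_le hμ hσ hq.1 hq.2)).1]
      · filter_upwards [self_mem_nhdsWithin] with q hq
        linarith [(abs_le.1 (abs_dirichletSol_sub_le hμ hσ hq.1 hq.2)).2]
    · refine ContinuousAt.continuousWithinAt ?_
      have h1 : (fun q : ℝ × ℝ => dirichletSol μ σ q.1 q.2) =ᶠ[𝓝 (x, t)] fun q =>
          meanPosPart (q.1 + μ * q.2) (σ * √q.2) -
            Real.exp (-(2 * μ / σ ^ 2) * q.1) * meanPosPart (μ * q.2 - q.1) (σ * √q.2) := by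
        filter_upwards [continuous_snd.continuousAt.eventually (lt_mem_nhds h)] with q hq
          using dirichletSol_of_pos hq
      refine ContinuousAt.congr ?_ h1.symm
      have hs : σ * √t ≠ 0 := (mul_pos hσ (Real.sqrt_pos.2 h)).ne'
      have d1 : ContinuousAt (fun q : ℝ × ℝ => (q.1 + μ * q.2) / (σ * √q.2)) (x, t) :=
        ContinuousAt.div (by fun_prop) (by fun_prop) hs
      have d2 : ContinuousAt (fun q : ℝ × ℝ => (μ * q.2 - q.1) / (σ * √q.2)) (x, t) :=
        ContinuousAt.div (by fun_prop) (by fun_prop) hs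
      have c1 := continuous_normalCdf.continuousAt.comp' d1
      have c2 := continuous_normalCdf.continuousAt.comp' d2
      have p1 := continuous_normalPdf.continuousAt.comp' d1
      have p2 := continuous_normalPdf.continuousAt.comp' d2
      unfold meanPosPart
      fun_prop
  diff_t x _ t ht := (hasDerivAt_dirichletSol_time hσ ht x).differentiableAt
  diff_x x _ t ht := (hasDerivAt_dirichletSol hσ ht x).differentiableAt
  diff_xx x _ t ht := by
    rw [funext fun y => (hasDerivAt_dirichletSol (μ := μ) hσ ht y).deriv]
    exact (hasDerivAt_dirichletSolDeriv hσ ht x).differentiableAt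
  eqn x _ t ht := by
    unfold gen
    rw [funext fun y => (hasDerivAt_dirichletSol (μ := μ) hσ ht y).deriv,
      (hasDerivAt_dirichletSolDeriv hσ ht x).deriv, (hasDerivAt_dirichletSol_time hσ ht x).deriv]
    simp only [dirichletSolDeriv]
    field_simp
    ring
  boundary t ht := dirichletSol_zero ht.le
  initial x _ := by simp [dirichletSol]
  growth T _ := by
    refine ⟨1 + 2 * (μ * T + σ * √T), fun x hx t ht htT => ?_⟩
    have h1 := abs_le.1 (abs_dirichletSol_sub_le hμ hσ hx ht)
    have h2 : μ * t + σ * √t ≤ μ * T + σ * √T := by gcongr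
    have h3 : 0 ≤ μ * t + σ * √t := by positivity
    have h4 : 0 ≤ (μ * T + σ * √T) * x := mul_nonneg (h3.trans h2) hx
    rw [abs_le]
    constructor <;> nlinarith

/-- The difference f - g satisfies the equation with zero data, so the maximum principle applies;
exchanging f and g yields uniqueness. -/
theorem IsDirichletSolution.le {μ σ : ℝ} (hμ : 0 < μ) {f g : ℝ → ℝ → ℝ}
    (hf : IsDirichletSolution μ σ f) (hg : IsDirichletSolution μ σ g) {x t : ℝ} (hx : 0 ≤ x)
    (ht : 0 < t) : f x t ≤ g x t := by
  obtain ⟨C, hC⟩ := hf.growth t ht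
  obtain ⟨D, hD⟩ := hg.growth t ht
  -- The data prescribe nothing at the corner; continuity along x = 0 fixes the value there.
  have hcont : ∀ k : ℝ → ℝ → ℝ, IsDirichletSolution μ σ k → k 0 0 = 0 := by
    intro k hk
    have h1 : Tendsto (fun s : ℝ => k 0 s) (𝓝[>] 0) (𝓝 (k 0 0)) := by
      have h2 := hk.cont (0, 0) ⟨Set.self_mem_Ici, Set.self_mem_Ici⟩
      refine h2.tendsto.comp (g := fun q : ℝ × ℝ => k q.1 q.2) (f := fun s : ℝ => ((0 : ℝ), s))
        (tendsto_nhdsWithin_iff.2 ⟨?_, ?_⟩)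
      · have : Continuous fun s : ℝ => ((0 : ℝ), s) := by fun_prop
        exact (this.tendsto 0).mono_left nhdsWithin_le_nhds
      · filter_upwards [self_mem_nhdsWithin] with s hs
        exact ⟨Set.self_mem_Ici, (show (0 : ℝ) < s from hs).le⟩
    refine tendsto_nhds_unique h1 (tendsto_const_nhds.congr' ?_)
    filter_upwards [self_mem_nhdsWithin] with s hs using (hk.boundary s hs).symm
  have hx1 : ∀ y > 0, ∀ s > 0, HasDerivAt (fun y => f y s - g y s)
      (deriv (fun y => f y s) y - deriv (fun y => g y s) y) y := fun y hy s hs =>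
    (hf.diff_x y hy s hs).hasDerivAt.sub (hg.diff_x y hy s hs).hasDerivAt
  have hxe : ∀ y > 0, ∀ s > 0, deriv (fun y => f y s - g y s) =ᶠ[𝓝 y]
      fun y => deriv (fun y => f y s) y - deriv (fun y => g y s) y := fun y hy s hs => by
    filter_upwards [lt_mem_nhds hy] with z hz using (hx1 z hz s hs).deriv
  have hx2 : ∀ y > 0, ∀ s > 0, HasDerivAt (deriv fun y => f y s - g y s)
      (deriv (deriv fun y => f y s) y - deriv (deriv fun y => g y s) y) y := fun y hy s hs =>
    ((hf.diff_xx y hy s hs).hasDerivAt.sub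
      (hg.diff_xx y hy s hs).hasDerivAt).congr_of_eventuallyEq (hxe y hy s hs)
  have h1 := nonpos_of_subsolution (σ := σ) hμ (w := fun x t => f x t - g x t) (T := t)
    (C := C + D) (hf.cont.sub hg.cont)
    (fun y hy s hs => (hf.diff_t y hy s hs).sub (hg.diff_t y hy s hs))
    (fun y hy s hs => (hx1 y hy s hs).differentiableAt)
    (fun y hy s hs => (hx2 y hy s hs).differentiableAt)
    (fun y hy s hs => by
      have e1 := hf.eqn y hy s hs
      have e2 := hg.eqn y hy s hs
      have e3 : deriv (fun s => f y s - g y s) s = deriv (fun s => f y s) s -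
          deriv (fun s => g y s) s :=
        ((hf.diff_t y hy s hs).hasDerivAt.sub (hg.diff_t y hy s hs).hasDerivAt).deriv
      unfold gen at e1 e2 ⊢
      rw [e3, (hx1 y hy s hs).deriv, (hx2 y hy s hs).deriv, e1, e2]
      exact le_of_eq (by ring))
    (fun s hs => by simp [hf.boundary s hs, hg.boundary s hs])
    (fun y hy => by
      rcases (show 0 ≤ y from hy).eq_or_lt with h | h
      · subst h
        simp [hcont f hf, hcont g hg]
      · simp [hf.initial y h, hg.initial y h])
    (fun y hy s hs hst => by
      have a1 := (abs_le.1 (hC y hy s hs hst)).2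
      have a2 := (abs_le.1 (hD y hy s hs hst)).1
      linarith)
    x hx t ht.le le_rfl
  linarith

/-- The solution of the Dirichlet problem is given by the method of images. -/
theorem h_eq_dirichletSol {μ σ x t : ℝ} (hμ : 0 < μ) (hσ : 0 < σ) (hx : 0 ≤ x) (ht : 0 < t) :
    h μ σ x t = dirichletSol μ σ x t := by
  have h1 := isDirichletSolution_dirichletSol hμ hσ
  have h2 : IsDirichletSolution μ σ (h μ σ) := Classical.epsilon_spec ⟨_, h1⟩
  exact le_antisymm (h2.le hμ h1 hx ht) (h1.le hμ h2 hx ht)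

theorem h_zero {μ σ t : ℝ} (hμ : 0 < μ) (hσ : 0 < σ) (ht : 0 < t) : h μ σ 0 t = 0 := by
  rw [h_eq_dirichletSol hμ hσ le_rfl ht, dirichletSol_zero ht.le]

theorem abs_h_sub_le {μ σ x t : ℝ} (hμ : 0 < μ) (hσ : 0 < σ) (hx : 0 ≤ x) (ht : 0 < t) :
    |h μ σ x t - x| ≤ 2 * (μ * t + σ * √t) := by
  rw [h_eq_dirichletSol hμ hσ hx ht]
  exact abs_dirichletSol_sub_le hμ hσ hx ht.le

theorem continuousOn_h {μ σ t : ℝ} (hμ : 0 < μ) (hσ : 0 < σ) (ht : 0 < t) :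
    ContinuousOn (fun x => h μ σ x t) (Set.Ici 0) := by
  have h1 : Continuous fun x => dirichletSol μ σ x t :=
    continuous_iff_continuousAt.2 fun x => (hasDerivAt_dirichletSol hσ ht x).continuousAt
  exact h1.continuousOn.congr fun x hx => h_eq_dirichletSol hμ hσ hx ht

theorem abs_derivWithin_h_le {μ σ t : ℝ} (hμ : 0 < μ) (hσ : 0 < σ) (ht : 0 < t) :
    |derivWithin (fun x => h μ σ x t) (Set.Ici 0) 0| ≤
      2 + 2 * μ / σ ^ 2 * (μ * t + σ * √t) := by
  have h1 : derivWithin (fun x => h μ σ x t) (Set.Ici 0) 0 = dirichletSolDeriv μ σ 0 t := by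
    have h2 : HasDerivWithinAt (fun x => h μ σ x t) (dirichletSolDeriv μ σ 0 t) (Set.Ici 0) 0 :=
      (hasDerivAt_dirichletSol hσ ht 0).hasDerivWithinAt.congr
        (fun x hx => h_eq_dirichletSol hμ hσ hx ht) (h_eq_dirichletSol hμ hσ le_rfl ht)
    exact h2.derivWithin (uniqueDiffOn_Ici (0 : ℝ) 0 Set.self_mem_Ici)
  rw [h1, dirichletSolDeriv]
  have hs : 0 < σ * √t := mul_pos hσ (Real.sqrt_pos.2 ht)
  have h2 := abs_le.1 (abs_meanPosPart_sub_le (a := μ * t) hs)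
  rw [max_eq_left (by positivity)] at h2
  have h3 : |meanPosPart (μ * t) (σ * √t)| ≤ μ * t + σ * √t := by
    have : 0 < μ * t := by positivity
    exact abs_le.2 ⟨by linarith, by linarith⟩
  have h4 : |2 * μ / σ ^ 2 * meanPosPart (μ * t) (σ * √t)| ≤
      2 * μ / σ ^ 2 * (μ * t + σ * √t) := by
    rw [abs_mul, abs_of_pos (by positivity : 0 < 2 * μ / σ ^ 2)]
    gcongr
  simp only [zero_add, mul_zero, Real.exp_zero, one_mul, sub_zero]
  have h5 := abs_le.1 h4
  have h6 := normalCdf_nonneg (μ * t / (σ * √t))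
  have h7 := normalCdf_le_one (μ * t / (σ * √t))
  rw [abs_le]
  constructor <;> linarith [h5.1, h5.2]

end BankModel

namespace BankModel

/-! ### Properties of `V₀` -/

section

variable {μ σ ρ : ℝ}

theorem lt_sqrt_discriminant (hσ : 0 < σ) (hρ : 0 < ρ) :
    μ < √(μ ^ 2 + 2 * σ ^ 2 * ρ) := by
  apply Real.lt_sqrt_of_sq_lt
  have : 0 < 2 * σ ^ 2 * ρ := by positivity
  linarith

theorem r₁_pos (hσ : 0 < σ) (hρ : 0 < ρ) : 0 < r₁ μ σ ρ :=
  div_pos (by linarith [lt_sqrt_discriminant (μ := μ) hσ hρ]) (by positivity)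

theorem r₂_pos (hμ : 0 < μ) (hσ : 0 < σ) : 0 < r₂ μ σ ρ :=
  div_pos (add_pos_of_pos_of_nonneg hμ (Real.sqrt_nonneg _)) (by positivity)

theorem hasDerivAt_V₀ (x : ℝ) : HasDerivAt (V₀ μ σ ρ)
    ((r₁ μ σ ρ * Real.exp (r₁ μ σ ρ * x) + r₂ μ σ ρ * Real.exp (-(r₂ μ σ ρ) * x)) /
      (r₁ μ σ ρ * Real.exp (r₁ μ σ ρ * u₀ μ σ ρ) +
        r₂ μ σ ρ * Real.exp (-(r₂ μ σ ρ) * u₀ μ σ ρ))) x := by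
  have h1 := ((hasDerivAt_id x).const_mul (r₁ μ σ ρ)).exp
  have h2 := ((hasDerivAt_id x).const_mul (-(r₂ μ σ ρ))).exp
  refine ((h1.sub h2).div_const _).congr_deriv ?_
  simp only [id]; ring

theorem hasDerivAt_deriv_V₀ (x : ℝ) : HasDerivAt (deriv (V₀ μ σ ρ))
    ((r₁ μ σ ρ ^ 2 * Real.exp (r₁ μ σ ρ * x) - r₂ μ σ ρ ^ 2 * Real.exp (-(r₂ μ σ ρ) * x)) /
      (r₁ μ σ ρ * Real.exp (r₁ μ σ ρ * u₀ μ σ ρ) +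
        r₂ μ σ ρ * Real.exp (-(r₂ μ σ ρ) * u₀ μ σ ρ))) x := by
  rw [funext fun y => (hasDerivAt_V₀ (μ := μ) (σ := σ) (ρ := ρ) y).deriv]
  have h1 := (((hasDerivAt_id x).const_mul (r₁ μ σ ρ)).exp).const_mul (r₁ μ σ ρ)
  have h2 := (((hasDerivAt_id x).const_mul (-(r₂ μ σ ρ))).exp).const_mul (r₂ μ σ ρ)
  refine ((h1.add h2).div_const _).congr_deriv ?_
  simp only [id]; ring

theorem differentiable_V₀ : Differentiable ℝ (V₀ μ σ ρ) := fun x =>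
  (hasDerivAt_V₀ x).differentiableAt

theorem continuous_V₀ : Continuous (V₀ μ σ ρ) := differentiable_V₀.continuous

variable (hμ : 0 < μ) (hσ : 0 < σ) (hρ : 0 < ρ)

include hμ hσ hρ

theorem strictMono_deriv_deriv_V₀ : StrictMono (deriv (deriv (V₀ μ σ ρ))) := by
  have p1 := r₁_pos (μ := μ) hσ hρ
  have p2 := r₂_pos (ρ := ρ) hμ hσ
  rw [funext fun y => (hasDerivAt_deriv_V₀ (μ := μ) (σ := σ) (ρ := ρ) y).deriv]
  intro x y hxy
  have h1 : Real.exp (r₁ μ σ ρ * x) < Real.exp (r₁ μ σ ρ * y) :=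
    Real.exp_lt_exp.2 (mul_lt_mul_of_pos_left hxy p1)
  have h2 : Real.exp (-(r₂ μ σ ρ) * y) < Real.exp (-(r₂ μ σ ρ) * x) :=
    Real.exp_lt_exp.2 (mul_lt_mul_of_neg_left hxy (by linarith))
  have h3 := mul_lt_mul_of_pos_left h1 (pow_pos p1 2)
  have h4 := mul_lt_mul_of_pos_left h2 (pow_pos p2 2)
  exact div_lt_div_of_pos_right (by linarith) (by positivity)

/-- At u₀ the equation reads σ²/2 · V₀'' + μ · 1 - ρ · μ/ρ = 0. So u₀ is the inflection point and
V₀' is minimal there. -/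
theorem deriv_deriv_V₀_u₀ : deriv (deriv (V₀ μ σ ρ)) (u₀ μ σ ρ) = 0 := by
  obtain ⟨-, h1, -, h2, h3⟩ := V₀_spec hμ hσ hρ
  have h4 := h1 (u₀ μ σ ρ)
  rw [gen, h2, h3] at h4
  field_simp at h4
  have : σ ^ 2 * deriv (deriv (V₀ μ σ ρ)) (u₀ μ σ ρ) = 0 := by linarith
  exact (mul_eq_zero.1 this).resolve_left (by positivity)

theorem strictAntiOn_deriv_V₀ : StrictAntiOn (deriv (V₀ μ σ ρ)) (Set.Iic (u₀ μ σ ρ)) := by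
  refine strictAntiOn_of_deriv_neg (convex_Iic _)
    (fun x _ => (hasDerivAt_deriv_V₀ x).continuousAt.continuousWithinAt) fun x hx => ?_
  rw [interior_Iic] at hx
  rw [← deriv_deriv_V₀_u₀ hμ hσ hρ]
  exact strictMono_deriv_deriv_V₀ hμ hσ hρ hx

theorem strictMonoOn_deriv_V₀ : StrictMonoOn (deriv (V₀ μ σ ρ)) (Set.Ici (u₀ μ σ ρ)) := by
  refine strictMonoOn_of_deriv_pos (convex_Ici _)
    (fun x _ => (hasDerivAt_deriv_V₀ x).continuousAt.continuousWithinAt) fun x hx => ?_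
  rw [interior_Ici] at hx
  rw [← deriv_deriv_V₀_u₀ hμ hσ hρ]
  exact strictMono_deriv_deriv_V₀ hμ hσ hρ hx

theorem one_le_deriv_V₀ (x : ℝ) : 1 ≤ deriv (V₀ μ σ ρ) x := by
  rw [← (V₀_spec hμ hσ hρ).2.2.2.2]
  rcases le_total x (u₀ μ σ ρ) with h | h
  · exact (strictAntiOn_deriv_V₀ hμ hσ hρ).antitoneOn h Set.self_mem_Iic h
  · exact (strictMonoOn_deriv_V₀ hμ hσ hρ).monotoneOn Set.self_mem_Ici h h

theorem one_lt_deriv_V₀ {x : ℝ} (hx : x < u₀ μ σ ρ) : 1 < deriv (V₀ μ σ ρ) x := by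
  rw [← (V₀_spec hμ hσ hρ).2.2.2.2]
  exact strictAntiOn_deriv_V₀ hμ hσ hρ hx.le Set.self_mem_Iic hx

theorem V₀_add_le {x y : ℝ} (hxy : x ≤ y) : V₀ μ σ ρ x + (y - x) ≤ V₀ μ σ ρ y := by
  have := mul_sub_le_image_sub_of_le_deriv (C := 1) differentiable_V₀
    (one_le_deriv_V₀ hμ hσ hρ) hxy
  linarith

theorem strictMono_V₀ : StrictMono (V₀ μ σ ρ) := fun x y hxy => by
  linarith [V₀_add_le hμ hσ hρ hxy.le]

theorem V₀_nonneg {x : ℝ} (hx : 0 ≤ x) : 0 ≤ V₀ μ σ ρ x := by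
  rw [← (V₀_spec hμ hσ hρ).2.2.1]
  exact (strictMono_V₀ hμ hσ hρ).monotone hx

/-- Below `u₀`, the increments of `V₀` are at least as large as the right end slope tells. -/
theorem deriv_V₀_mul_sub_le {x y : ℝ} (hxy : x ≤ y) (hy : y ≤ u₀ μ σ ρ) :
    deriv (V₀ μ σ ρ) y * (y - x) ≤ V₀ μ σ ρ y - V₀ μ σ ρ x := by
  refine (convex_Icc x y).mul_sub_le_image_sub_of_le_deriv continuous_V₀.continuousOn
    differentiable_V₀.differentiableOn (fun z hz => ?_) x (Set.left_mem_Icc.2 hxy) y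
    (Set.right_mem_Icc.2 hxy) hxy
  rw [interior_Icc] at hz
  exact (strictAntiOn_deriv_V₀ hμ hσ hρ).antitoneOn (hz.2.le.trans hy) hy hz.2.le

theorem V₀_sub_le_deriv_mul {x y : ℝ} (hxy : x ≤ y) (hy : y ≤ u₀ μ σ ρ) :
    V₀ μ σ ρ y - V₀ μ σ ρ x ≤ deriv (V₀ μ σ ρ) x * (y - x) := by
  refine (convex_Icc x y).image_sub_le_mul_sub_of_deriv_le continuous_V₀.continuousOn
    differentiable_V₀.differentiableOn (fun z hz => ?_) x (Set.left_mem_Icc.2 hxy) y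
    (Set.right_mem_Icc.2 hxy) hxy
  rw [interior_Icc] at hz
  exact (strictAntiOn_deriv_V₀ hμ hσ hρ).antitoneOn (hxy.trans hy) (hz.2.le.trans hy) hz.1.le

/-- To the right of a point below `u₀`, `V₀` gains on the identity. -/
theorem exists_V₀_gain {x : ℝ} (hx : x < u₀ μ σ ρ) : ∃ κ > 0, ∃ η > 0, ∀ d ≥ 0,
    V₀ μ σ ρ x + d + κ * min d η ≤ V₀ μ σ ρ (x + d) := by
  set η := (u₀ μ σ ρ - x) / 2 with hη
  have hη0 : 0 < η := by linarith
  have hxη : x + η < u₀ μ σ ρ := by linarith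
  refine ⟨deriv (V₀ μ σ ρ) (x + η) - 1, by linarith [one_lt_deriv_V₀ hμ hσ hρ hxη], η, hη0,
    fun d hd => ?_⟩
  have key : ∀ e, 0 ≤ e → e ≤ η → V₀ μ σ ρ x + e + (deriv (V₀ μ σ ρ) (x + η) - 1) * e ≤
      V₀ μ σ ρ (x + e) := by
    intro e he heη
    have h1 := deriv_V₀_mul_sub_le hμ hσ hρ (show x ≤ x + e by linarith) (by linarith)
    have h2 : deriv (V₀ μ σ ρ) (x + η) ≤ deriv (V₀ μ σ ρ) (x + e) :=
      (strictAntiOn_deriv_V₀ hμ hσ hρ).antitoneOn (show x + e ≤ _ by linarith) hxη.le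
        (by linarith)
    nlinarith
  rcases le_total d η with h | h
  · rw [min_eq_left h]
    exact key d hd h
  · rw [min_eq_right h]
    have h1 := key η hη0.le le_rfl
    have h2 := V₀_add_le hμ hσ hρ (show x + η ≤ x + d by linarith)
    linarith

/-- V₀(z) - z is nondecreasing and goes from 0 at z = 0 to μ/ρ - u₀ at z = u₀. The value sought lies
strictly between. -/
theorem uHat_spec {K : ℝ} (hK : 0 < K) (hK' : K < μ / ρ - u₀ μ σ ρ) :
    0 < uHat μ σ ρ K ∧ uHat μ σ ρ K < u₀ μ σ ρ ∧
      V₀ μ σ ρ (uHat μ σ ρ K) = uHat μ σ ρ K + μ / ρ - K - u₀ μ σ ρ := by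
  obtain ⟨h0, -, h1, h2, -⟩ := V₀_spec hμ hσ hρ
  have hcont : Continuous fun z => V₀ μ σ ρ z - z := continuous_V₀.sub continuous_id
  have hex : ∃ z, V₀ μ σ ρ z = z + μ / ρ - K - u₀ μ σ ρ := by
    obtain ⟨z, -, hz⟩ := intermediate_value_Icc h0.le hcont.continuousOn
      (show μ / ρ - K - u₀ μ σ ρ ∈ Set.Icc _ _ from
        ⟨by simp only [h1]; linarith, by simp only [h2]; linarith⟩)
    exact ⟨z, by linarith⟩
  have hspec : V₀ μ σ ρ (uHat μ σ ρ K) = uHat μ σ ρ K + μ / ρ - K - u₀ μ σ ρ :=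
    Classical.epsilon_spec hex
  refine ⟨?_, ?_, hspec⟩
  · by_contra! h
    have := V₀_add_le hμ hσ hρ h
    linarith
  · by_contra! h
    have := V₀_add_le hμ hσ hρ h
    linarith

end

end BankModel

namespace BankModel

variable {Ω : Type*} [MeasurableSpace Ω] {P : Measure Ω} {W : ℝ≥0 → Ω → ℝ} {μ σ ρ : ℝ}

/-! ### The threshold for a fixed observation period -/

/-- The set whose supremum is `u₂ β t` for `β > betaCrit t`. -/
def feasible (P : Measure Ω) (W : ℝ≥0 → Ω → ℝ) (μ σ ρ β t : ℝ) : Set ℝ :=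
  {z : ℝ | ∀ x ≥ 0, β * (1 - p P W μ σ x t) + h μ σ x t ≤
    Real.exp (ρ * t) * V₀ μ σ ρ (x - z + u₀ μ σ ρ)}

theorem u₂_of_gt {β t : ℝ} (hβ : betaCrit P W μ σ ρ t < β) :
    u₂ P W μ σ ρ β t = sSup (feasible P W μ σ ρ β t) := if_neg (not_le.2 hβ)

variable (hW : IsBrownianReal W P) (hμ : 0 < μ) (hσ : 0 < σ) (hρ : 0 < ρ)

include hμ hσ hρ in
theorem feasible_of_le {β t z z' : ℝ} (hz : z ≤ z') (hz' : z' ∈ feasible P W μ σ ρ β t) :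
    z ∈ feasible P W μ σ ρ β t := fun x hx =>
  (hz' x hx).trans (mul_le_mul_of_nonneg_left
    ((strictMono_V₀ hμ hσ hρ).monotone (by linarith)) (Real.exp_pos _).le)

theorem isClosed_feasible (β t : ℝ) : IsClosed (feasible P W μ σ ρ β t) := by
  have h1 : feasible P W μ σ ρ β t = ⋂ x ≥ (0 : ℝ), {z : ℝ | β * (1 - p P W μ σ x t) + h μ σ x t ≤
      Real.exp (ρ * t) * V₀ μ σ ρ (x - z + u₀ μ σ ρ)} := by
    ext z; simp [feasible]
  rw [h1]
  refine isClosed_biInter fun x _ => isClosed_le continuous_const ?_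
  exact continuous_const.mul (continuous_V₀.comp (by fun_prop))

include hW in
theorem mul_one_sub_p_le (b x t : ℝ) : b * (1 - p P W μ σ x t) ≤ |b| := by
  have h1 := p_nonneg (P := P) (W := W) μ σ x t
  have h2 := p_le_one hW μ σ x t
  calc b * (1 - p P W μ σ x t) ≤ |b| * (1 - p P W μ σ x t) :=
        mul_le_mul_of_nonneg_right (le_abs_self b) (by linarith)
    _ ≤ |b| := mul_le_of_le_one_right (abs_nonneg b) (by linarith)

include hW hμ hσ hρ

theorem feasible_nonempty (β : ℝ) {t : ℝ} (ht : 0 < t) :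
    (feasible P W μ σ ρ β t).Nonempty := by
  set C := 2 * (μ * t + σ * √t) with hC
  have hC0 : 0 ≤ C := by positivity
  refine ⟨-(|β| + C), fun x hx => ?_⟩
  have h1 := mul_one_sub_p_le hW (μ := μ) (σ := σ) β x t
  have h2 := (abs_le.1 (abs_h_sub_le hμ hσ hx ht)).2
  have hβ := abs_nonneg β
  obtain ⟨hu, -, -, h3, -⟩ := V₀_spec hμ hσ hρ
  have h4 := V₀_add_le hμ hσ hρ (show u₀ μ σ ρ ≤ x - -(|β| + C) + u₀ μ σ ρ by linarith)
  have h5 : 0 ≤ μ / ρ := by positivity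
  have h6 : V₀ μ σ ρ (x - -(|β| + C) + u₀ μ σ ρ) ≤
      Real.exp (ρ * t) * V₀ μ σ ρ (x - -(|β| + C) + u₀ μ σ ρ) :=
    le_mul_of_one_le_left (V₀_nonneg hμ hσ hρ (by linarith)) (Real.one_le_exp (by positivity))
  linarith

/-- At x = 0 the left side vanishes because p = 1 and h = 0, so V₀(u₀ - z) ≥ 0. -/
theorem le_u₀_of_mem_feasible {β t z : ℝ} (ht : 0 < t) (hz : z ∈ feasible P W μ σ ρ β t) :
    z ≤ u₀ μ σ ρ := by
  have h1 := hz 0 le_rfl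
  rw [p_zero hW μ σ ht, h_zero hμ hσ ht] at h1
  simp only [sub_self, mul_zero, add_zero, zero_sub] at h1
  have h2 := nonneg_of_mul_nonneg_right h1 (Real.exp_pos _)
  rw [← (V₀_spec hμ hσ hρ).2.2.1] at h2
  linarith [(strictMono_V₀ hμ hσ hρ).le_iff_le.1 h2]

theorem bddAbove_feasible (β : ℝ) {t : ℝ} (ht : 0 < t) : BddAbove (feasible P W μ σ ρ β t) :=
  ⟨u₀ μ σ ρ, fun _ hz => le_u₀_of_mem_feasible hW hμ hσ hρ ht hz⟩

theorem csSup_feasible_mem (β : ℝ) {t : ℝ} (ht : 0 < t) :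
    sSup (feasible P W μ σ ρ β t) ∈ feasible P W μ σ ρ β t :=
  (isClosed_feasible β t).csSup_mem (feasible_nonempty hW hμ hσ hρ β ht)
    (bddAbove_feasible hW hμ hσ hρ β ht)

theorem csSup_feasible_antitone {β β' t : ℝ} (ht : 0 < t) (hβ : β ≤ β') :
    sSup (feasible P W μ σ ρ β' t) ≤ sSup (feasible P W μ σ ρ β t) := by
  refine csSup_le_csSup (bddAbove_feasible hW hμ hσ hρ β ht)
    (feasible_nonempty hW hμ hσ hρ β' ht) fun z hz x hx => ?_
  have h1 := hz x hx
  have h2 := mul_le_mul_of_nonneg_right hβ (sub_nonneg.2 (p_le_one hW μ σ x t))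
  linarith

/-- As V₀' ≥ 1, lowering z by (β' - β)e^{-ρt} raises the right side by at least β' - β, which pays
for the larger β'. -/
theorem csSup_feasible_sub_le {β β' t : ℝ} (ht : 0 < t) (hβ : β ≤ β') :
    sSup (feasible P W μ σ ρ β t) - (β' - β) / Real.exp (ρ * t) ≤
      sSup (feasible P W μ σ ρ β' t) := by
  refine le_csSup (bddAbove_feasible hW hμ hσ hρ β' ht) fun x hx => ?_
  have h1 := csSup_feasible_mem hW hμ hσ hρ β ht x hx
  set z := sSup (feasible P W μ σ ρ β t)
  have hE : 0 < Real.exp (ρ * t) := Real.exp_pos _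
  set E := Real.exp (ρ * t)
  have hd : 0 ≤ (β' - β) / E := div_nonneg (by linarith) hE.le
  have h2 := V₀_add_le hμ hσ hρ
    (show x - z + u₀ μ σ ρ ≤ x - (z - (β' - β) / E) + u₀ μ σ ρ by linarith)
  have h3 := mul_le_mul_of_nonneg_left h2 hE.le
  have h4 : E * (V₀ μ σ ρ (x - z + u₀ μ σ ρ) + (x - (z - (β' - β) / E) + u₀ μ σ ρ -
      (x - z + u₀ μ σ ρ))) = E * V₀ μ σ ρ (x - z + u₀ μ σ ρ) + (β' - β) := by
    field_simp; ring
  have h5 : (β' - β) * (1 - p P W μ σ x t) ≤ β' - β :=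
    mul_le_of_le_one_right (by linarith) (by linarith [p_nonneg (P := P) (W := W) μ σ x t])
  linarith

theorem continuous_csSup_feasible {t : ℝ} (ht : 0 < t) :
    Continuous fun β => sSup (feasible P W μ σ ρ β t) := by
  refine (LipschitzWith.of_le_add fun β β' => ?_).continuous
  have hE : 1 ≤ Real.exp (ρ * t) := Real.one_le_exp (by positivity)
  rcases le_total β β' with h | h
  · have h1 := csSup_feasible_sub_le hW hμ hσ hρ ht h
    have h2 : (β' - β) / Real.exp (ρ * t) ≤ β' - β := div_le_self (by linarith) hE
    have h3 : β' - β ≤ dist β β' := by rw [dist_comm]; exact le_abs_self _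
    linarith
  · linarith [csSup_feasible_antitone hW hμ hσ hρ ht h, dist_nonneg (x := β) (y := β')]

/-- The supremum falls at rate at most e^{-ρt} < 1 in β. -/
theorem strictMono_add_csSup_feasible {t : ℝ} (ht : 0 < t) :
    StrictMono fun β => β + sSup (feasible P W μ σ ρ β t) := by
  intro β β' h
  have h1 := csSup_feasible_sub_le hW hμ hσ hρ ht h.le
  have h2 : (β' - β) / Real.exp (ρ * t) < β' - β :=
    div_lt_self (by linarith) (Real.one_lt_exp_iff.2 (by positivity))
  simp only
  linarith

omit hρ

/-! ### The critical level -/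

omit hW hμ hσ in
/-- If `f` leaves `1` at least at rate `c` at the boundary of the half line, then the reciprocal
of its one-sided derivative is at most `1 / c`. -/
theorem abs_inv_derivWithin_le {f : ℝ → ℝ} {c δ : ℝ} (hc : 0 < c) (hδ : 0 < δ) (h0 : f 0 = 1)
    (hf : ∀ x, 0 ≤ x → x ≤ δ → c * x ≤ 1 - f x) :
    |(derivWithin f (Set.Ici 0) 0)⁻¹| ≤ c⁻¹ := by
  by_cases hd : DifferentiableWithinAt ℝ f (Set.Ici 0) 0
  · have h1 := hd.hasDerivWithinAt.Ioi_of_Ici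
    rw [hasDerivWithinAt_iff_tendsto_slope' (by simp)] at h1
    have h2 : derivWithin f (Set.Ici 0) 0 ≤ -c := by
      refine le_of_tendsto h1 ?_
      filter_upwards [Ioo_mem_nhdsGT hδ] with x hx
      rw [slope_def_field, h0, sub_zero, div_le_iff₀ hx.1]
      linarith [hf x hx.1.le hx.2.le]
    rw [abs_inv, abs_of_nonpos (by linarith)]
    exact inv_anti₀ hc (by linarith)
  -- Without differentiability the derivative is 0 by default and so is its inverse; hence
  -- smoothness of p at the boundary need not be proved.
  · rw [derivWithin_zero_of_not_differentiableWithinAt hd]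
    simpa using hc.le

include hW hμ hσ

/-- The numerator stays bounded as t → 0, while 1 - p leaves 0 at a rate of order at least 1/√t. -/
theorem abs_betaCrit_le {t : ℝ} (ht : 0 < t) :
    |betaCrit P W μ σ ρ t| ≤ (2 + 2 * μ / σ ^ 2 * (μ * t + σ * √t) +
      Real.exp (ρ * t) * |deriv (V₀ μ σ ρ) 0|) * (σ * √t / (2 * normalPdf 1)) := by
  have hs : 0 < σ * √t := mul_pos hσ (Real.sqrt_pos.2 ht)
  have h1 := abs_inv_derivWithin_le (f := fun x => p P W μ σ x t)
    (div_pos (mul_pos two_pos (normalPdf_pos 1)) hs) hs (p_zero hW μ σ ht)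
    fun x hx hxt => one_sub_p_ge hW hμ hσ hx ht hxt
  rw [inv_div] at h1
  have h2 := abs_derivWithin_h_le hμ hσ ht
  rw [betaCrit, div_eq_mul_inv, abs_mul]
  refine mul_le_mul ((abs_sub _ _).trans ?_) h1 (abs_nonneg _) (by positivity)
  rw [abs_mul, Real.abs_exp]
  linarith

theorem tendsto_betaCrit : Tendsto (fun t => betaCrit P W μ σ ρ t) (𝓝[>] 0) (𝓝 0) := by
  refine squeeze_zero_norm' (a := fun t => (2 + 2 * μ / σ ^ 2 * (μ * t + σ * √t) +
      Real.exp (ρ * t) * |deriv (V₀ μ σ ρ) 0|) * (σ * √t / (2 * normalPdf 1))) ?_ ?_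
  · filter_upwards [self_mem_nhdsWithin] with t ht using abs_betaCrit_le hW hμ hσ ht
  · have h1 : Continuous fun t : ℝ => (2 + 2 * μ / σ ^ 2 * (μ * t + σ * √t) +
      Real.exp (ρ * t) * |deriv (V₀ μ σ ρ) 0|) * (σ * √t / (2 * normalPdf 1)) := by
      fun_prop
    simpa using (h1.tendsto 0).mono_left nhdsWithin_le_nhds

end BankModel

namespace BankModel

variable {Ω : Type*} [MeasurableSpace Ω] {P : Measure Ω} {W : ℝ≥0 → Ω → ℝ} {μ σ ρ : ℝ}

/-! ### The scale `σ √Δ √|log Δ|` -/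

/-- The order of magnitude of the thresholds for a short observation period. -/
noncomputable def scale (σ Δ : ℝ) : ℝ := σ * √Δ * √|Real.log Δ|

theorem tendsto_sqrt_abs_log : Tendsto (fun Δ : ℝ => √|Real.log Δ|) (𝓝[>] 0) atTop :=
  Real.tendsto_sqrt_atTop.comp (tendsto_abs_atBot_atTop.comp Real.tendsto_log_nhdsGT_zero)

theorem tendsto_scale (σ : ℝ) : Tendsto (scale σ) (𝓝[>] 0) (𝓝 0) := by
  have h1 : Tendsto (fun Δ : ℝ => σ * √(Real.negMulLog Δ)) (𝓝[>] 0) (𝓝 0) := by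
    have : Continuous fun Δ : ℝ => σ * √(Real.negMulLog Δ) := by fun_prop
    simpa using (this.tendsto 0).mono_left nhdsWithin_le_nhds
  refine h1.congr' ?_
  filter_upwards [Ioo_mem_nhdsGT one_pos] with Δ hΔ
  rw [scale, abs_of_neg (Real.log_neg hΔ.1 hΔ.2), mul_assoc, ← Real.sqrt_mul hΔ.1.le,
    Real.negMulLog]
  congr 2
  ring

theorem eventually_sqrt_le_mul_scale (hσ : 0 < σ) {c : ℝ} (hc : 0 < c) :
    ∀ᶠ Δ in 𝓝[>] 0, √Δ ≤ c * scale σ Δ := by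
  filter_upwards [tendsto_sqrt_abs_log.eventually_ge_atTop (1 / (c * σ))] with Δ h1
  have h2 : 1 ≤ c * σ * √|Real.log Δ| := by
    rw [div_le_iff₀ (by positivity)] at h1
    linarith
  calc √Δ = √Δ * 1 := (mul_one _).symm
    _ ≤ √Δ * (c * σ * √|Real.log Δ|) := by gcongr
    _ = c * scale σ Δ := by rw [scale]; ring

theorem scale_pos (hσ : 0 < σ) {Δ : ℝ} (hΔ : 0 < Δ) (hΔ' : Δ < 1) : 0 < scale σ Δ :=
  mul_pos (mul_pos hσ (Real.sqrt_pos.2 hΔ))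
    (Real.sqrt_pos.2 (abs_pos.2 (Real.log_neg hΔ hΔ').ne))

/-- This fixes the constant in the scale: at x = L the Gaussian exponent equals √Δ, the order of the
errors. -/
theorem sqrt_eq_exp {Δ : ℝ} (hΔ : 0 < Δ) (hΔ' : Δ < 1) :
    √Δ = Real.exp (-(√|Real.log Δ| ^ 2) / 2) := by
  rw [Real.sq_sqrt (abs_nonneg _), abs_of_neg (Real.log_neg hΔ hΔ'), neg_neg,
    Real.sqrt_eq_rpow, Real.rpow_def_of_pos hΔ]
  congr 1
  ring

theorem p_scale_le (hW : IsBrownianReal W P) (hμ : 0 < μ) (hσ : 0 < σ) {Δ : ℝ} (hΔ : 0 < Δ)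
    (hΔ' : Δ < 1) : p P W μ σ (scale σ Δ) Δ ≤ 2 * √Δ := by
  have hs : 0 < σ * √Δ := mul_pos hσ (Real.sqrt_pos.2 hΔ)
  have h1 := p_le hW hμ hσ (scale_pos hσ hΔ hΔ').le hΔ
  have h2 : scale σ Δ / (σ * √Δ) = √|Real.log Δ| := by
    rw [scale]; field_simp
  rw [h2] at h1
  have h3 := normalCdf_neg_le_exp (Real.sqrt_nonneg |Real.log Δ|)
  rw [← sqrt_eq_exp hΔ hΔ'] at h3
  linarith

/-- At a distance below the scale, the hitting probability dominates the scale. -/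
theorem eventually_mul_scale_le_p (hW : IsBrownianReal W P) (hμ : 0 < μ) (hσ : 0 < σ) {ε : ℝ}
    (hε : 0 < ε) (hε' : ε < 1) (M : ℝ) :
    ∀ᶠ Δ in 𝓝[>] 0, ∀ x ≥ 0, x ≤ (1 - ε) * scale σ Δ → M * scale σ Δ ≤ p P W μ σ x Δ := by
  -- The drift adds at most μ/σ to the normalized distance and the tail bound adds 1; both are
  -- absorbed by half of the margin ε.
  set b := μ / σ + 1 with hb
  have hb0 : 0 < b := by positivity
  set c := (√(2 * Real.pi))⁻¹ with hc
  have hc0 : 0 < c := by positivity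
  filter_upwards [tendsto_sqrt_abs_log.eventually_ge_atTop (2 * b / ε),
    tendsto_sqrt_abs_log.eventually_ge_atTop (4 * M * σ / (c * ε)),
    Ioo_mem_nhdsGT one_pos] with Δ h1 h2 hΔ x hx hxs
  set l := √|Real.log Δ| with hl
  have hl0 : 0 ≤ l := Real.sqrt_nonneg _
  have hq : 0 < √Δ := Real.sqrt_pos.2 hΔ.1
  have hs : 0 < σ * √Δ := mul_pos hσ hq
  rw [div_le_iff₀ hε] at h1
  rw [div_le_iff₀ (by positivity)] at h2
  have hμΔ : 0 < μ * Δ := mul_pos hμ hΔ.1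
  have hv0 : 0 ≤ (x + μ * Δ) / (σ * √Δ) := div_nonneg (by linarith) hs.le
  have hv : (x + μ * Δ) / (σ * √Δ) + 1 ≤ (1 - ε / 2) * l := by
    have e1 : (x + μ * Δ) / (σ * √Δ) ≤ (1 - ε) * l + μ / σ := by
      rw [div_le_iff₀ hs]
      have e2 : ((1 - ε) * l + μ / σ) * (σ * √Δ) = (1 - ε) * scale σ Δ + μ * √Δ := by
        rw [scale, ← hl]; field_simp
      rw [e2]
      have e3 : Δ ≤ √Δ := Real.le_sqrt_of_sq_le (by nlinarith [hΔ.1, hΔ.2])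
      have e4 := mul_le_mul_of_nonneg_left e3 hμ.le
      linarith
    rw [hb] at h1
    linarith
  have h3 : normalPdf ((1 - ε / 2) * l) ≤ p P W μ σ x Δ :=
    (normalPdf_anti (by linarith) hv).trans
      ((normalPdf_le_normalCdf_neg hv0).trans (le_p hW hσ hx hΔ.1))
  refine le_trans ?_ h3
  rw [normalPdf_eq, ← hc, scale, sqrt_eq_exp hΔ.1 hΔ.2, ← hl]
  -- The margin leaves a factor exp(εl²/4) to spare, which beats the linear factor l of the scale.
  have h4 : M * σ * l ≤ c * Real.exp (ε * l ^ 2 / 4) := by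
    have e1 : 1 + ε * l ^ 2 / 4 ≤ Real.exp (ε * l ^ 2 / 4) := by
      linarith [Real.add_one_le_exp (ε * l ^ 2 / 4)]
    have e2 := mul_le_mul_of_nonneg_left e1 hc0.le
    have e3 := mul_le_mul_of_nonneg_right h2 hl0
    nlinarith
  have h5 : Real.exp (ε * l ^ 2 / 4) * Real.exp (-(l ^ 2) / 2) ≤
      Real.exp (-(((1 - ε / 2) * l) ^ 2) / 2) := by
    rw [← Real.exp_add, Real.exp_le_exp]
    have : 0 ≤ ε * l ^ 2 * (2 - ε) := by
      have : 0 ≤ 2 - ε := by linarith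
      positivity
    nlinarith [mul_nonneg (mul_nonneg hε.le (sq_nonneg l)) (show 0 ≤ 1 - ε by linarith)]
  calc M * (σ * Real.exp (-(l ^ 2) / 2) * l) = M * σ * l * Real.exp (-(l ^ 2) / 2) := by ring
    _ ≤ c * Real.exp (ε * l ^ 2 / 4) * Real.exp (-(l ^ 2) / 2) := by gcongr
    _ = c * (Real.exp (ε * l ^ 2 / 4) * Real.exp (-(l ^ 2) / 2)) := by ring
    _ ≤ _ := by gcongr

/-! ### Asymptotic location of the thresholds -/

theorem abs_h_sub_le_sqrt (hμ : 0 < μ) (hσ : 0 < σ) {x Δ : ℝ} (hx : 0 ≤ x) (hΔ : 0 < Δ)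
    (hΔ' : Δ < 1) : |h μ σ x Δ - x| ≤ 2 * (μ + σ) * √Δ := by
  refine (abs_h_sub_le hμ hσ hx hΔ).trans ?_
  have e3 : Δ ≤ √Δ := Real.le_sqrt_of_sq_le (by nlinarith)
  have e4 := mul_le_mul_of_nonneg_left e3 hμ.le
  linarith

/-- Away from the scale, the inequality defining the threshold holds with room to spare. -/
theorem eventually_gap (hW : IsBrownianReal W P) (hμ : 0 < μ) (hσ : 0 < σ) (hρ : 0 < ρ) {v : ℝ}
    (hv : 0 < v) (hv' : v < u₀ μ σ ρ) {ε : ℝ} (hε : 0 < ε) (hε' : ε < 1) :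
    ∀ᶠ Δ in 𝓝[>] 0, ∀ l, 0 ≤ l → l ≤ 2 * scale σ Δ → ∀ x ≥ 0,
      (x ≤ (1 - ε) * scale σ Δ ∨ l + ε * scale σ Δ ≤ x) →
      (V₀ μ σ ρ v - l) * (1 - p P W μ σ x Δ) + h μ σ x Δ ≤
        Real.exp (ρ * Δ) * V₀ μ σ ρ (v + x - l - √Δ) := by
  set B := V₀ μ σ ρ v with hB
  have hB0 : 0 < B := by
    rw [hB, ← (V₀_spec hμ hσ hρ).2.2.1]
    exact strictMono_V₀ hμ hσ hρ hv
  set C := 2 * (μ + σ) with hC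
  have hC0 : 0 < C := by positivity
  set M := deriv (V₀ μ σ ρ) 0 with hM
  have hM1 : 1 ≤ M := one_le_deriv_V₀ hμ hσ hρ 0
  obtain ⟨κ, hκ, η, hη, hgain⟩ := exists_V₀_gain hμ hσ hρ hv'
  filter_upwards [Ioo_mem_nhdsGT one_pos,
    eventually_mul_scale_le_p hW hμ hσ hε hε' (2 * (1 + C + 3 * M) / B),
    eventually_sqrt_le_mul_scale hσ one_pos,
    eventually_sqrt_le_mul_scale hσ (half_pos hε),
    eventually_sqrt_le_mul_scale hσ (show 0 < κ * (ε / 2) / (C + 1) by positivity),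
    (tendsto_scale σ).eventually_lt_const (show 0 < B / 4 by positivity),
    (tendsto_scale σ).eventually_lt_const (show 0 < v / 3 by positivity),
    (tendsto_scale σ).eventually_lt_const (show 0 < η by positivity)]
    with Δ hΔ hp hs1 hs2 hs3 hL1 hL2 hL3 l hl0 hl x hx hcase
  set L := scale σ Δ with hL
  have hL0 : 0 < L := scale_pos hσ hΔ.1 hΔ.2
  have hq : 0 < √Δ := Real.sqrt_pos.2 hΔ.1
  have hh := (abs_le.1 (abs_h_sub_le_sqrt hμ hσ hx hΔ.1 hΔ.2)).2
  rw [← hC] at hh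
  have hp0 := p_nonneg (P := P) (W := W) μ σ x Δ
  have hE : 1 ≤ Real.exp (ρ * Δ) := Real.one_le_exp (mul_pos hρ hΔ.1).le
  have hBl : B / 2 ≤ B - l := by linarith
  have hdrop : ∀ y, 0 ≤ y → V₀ μ σ ρ y ≤ Real.exp (ρ * Δ) * V₀ μ σ ρ y := fun y hy =>
    le_mul_of_one_le_left (V₀_nonneg hμ hσ hρ hy) hE
  rw [one_mul] at hs1
  -- On the left the loss Bp/2 ≥ (1 + C + 3M)L covers x ≤ L, the error of h (at most CL), and the
  -- drop of V₀ over the distance l + √Δ ≤ 3L, where its slope is at most M. On the right the gain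
  -- κ(ε/2)L of V₀ over the identity covers the error C√Δ of h and the shift √Δ.
  rcases hcase with hx1 | hx2
  · have h1 := hp x hx hx1
    rw [div_mul_eq_mul_div, div_le_iff₀ hB0] at h1
    have h2 : (B - l) * (1 - p P W μ σ x Δ) ≤ B - l - B / 2 * p P W μ σ x Δ := by
      have := mul_le_mul_of_nonneg_right hBl hp0
      linarith
    have hxL : x ≤ L := hx1.trans (mul_le_of_le_one_left hL0.le (by linarith))
    have h3 : B - M * (3 * L) ≤ V₀ μ σ ρ (v - 3 * L) := by
      have e1 := V₀_sub_le_deriv_mul hμ hσ hρ (show v - 3 * L ≤ v by linarith) hv'.le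
      have e2 : deriv (V₀ μ σ ρ) (v - 3 * L) ≤ M :=
        (strictAntiOn_deriv_V₀ hμ hσ hρ).antitoneOn (show (0 : ℝ) ≤ _ by linarith)
          (show v - 3 * L ≤ _ by linarith) (by linarith)
      have e3 := mul_le_mul_of_nonneg_right e2 (show 0 ≤ 3 * L by linarith)
      have e4 : v - (v - 3 * L) = 3 * L := by ring
      rw [e4] at e1
      linarith
    have h4 : V₀ μ σ ρ (v - 3 * L) ≤ V₀ μ σ ρ (v + x - l - √Δ) :=
      (strictMono_V₀ hμ hσ hρ).monotone (by linarith)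
    have h5 := hdrop (v + x - l - √Δ) (by linarith)
    have h6 := mul_le_mul_of_nonneg_left hs1 hC0.le
    linarith
  · have h1 : (B - l) * (1 - p P W μ σ x Δ) ≤ B - l :=
      mul_le_of_le_one_right (by linarith) (by linarith)
    have h2 := hgain (x - l - √Δ) (by linarith)
    have h3 : ε / 2 * L ≤ min (x - l - √Δ) η := by
      refine le_min (by linarith) ?_
      have : ε / 2 * L ≤ L := mul_le_of_le_one_left hL0.le (by linarith)
      linarith
    have h4 := mul_le_mul_of_nonneg_left h3 hκ.le
    rw [div_mul_eq_mul_div, le_div_iff₀ (by positivity)] at hs3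
    have h5 := hdrop (v + (x - l - √Δ)) (by nlinarith)
    have e : v + x - l - √Δ = v + (x - l - √Δ) := by ring
    rw [e]
    linarith

/-- Test at x = L. There p ≤ 2√Δ, so the left side is about B - εL, whereas the right side is about
B - V₀'(v)εL, which is smaller as V₀'(v) > 1. -/
theorem eventually_csSup_feasible_le (hW : IsBrownianReal W P) (hμ : 0 < μ) (hσ : 0 < σ)
    (hρ : 0 < ρ) {v : ℝ} (hv : 0 < v) (hv' : v < u₀ μ σ ρ) {ε : ℝ} (hε : 0 < ε) :
    ∀ᶠ Δ in 𝓝[>] 0, sSup (feasible P W μ σ ρ (V₀ μ σ ρ v - (1 + ε) * scale σ Δ) Δ) ≤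
      u₀ μ σ ρ - v + (1 + ε) * scale σ Δ := by
  set B := V₀ μ σ ρ v with hB
  have hB0 : 0 < B := by
    rw [hB, ← (V₀_spec hμ hσ hρ).2.2.1]
    exact strictMono_V₀ hμ hσ hρ hv
  set C := 2 * (μ + σ) with hC
  have hC0 : 0 < C := by positivity
  set κ := deriv (V₀ μ σ ρ) v - 1 with hκ
  have hκ0 : 0 < κ := by linarith [one_lt_deriv_V₀ hμ hσ hρ hv']
  -- The errors of order √Δ: 2B from p, C from h and 2ρB from the factor e^{ρΔ}. Feasibility would
  -- give κεL ≤ D√Δ ≤ κεL/2.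
  set D := 2 * B + C + 2 * ρ * B with hD
  have hD0 : 0 < D := by positivity
  filter_upwards [Ioo_mem_nhdsGT one_pos,
    Ioo_mem_nhdsGT (show 0 < 1 / ρ by positivity),
    eventually_sqrt_le_mul_scale hσ (show 0 < κ * ε / (2 * D) by positivity),
    (tendsto_scale σ).eventually_lt_const (show 0 < B / (1 + ε) by positivity)]
    with Δ hΔ hΔρ hs hL1
  set L := scale σ Δ with hL
  have hL0 : 0 < L := scale_pos hσ hΔ.1 hΔ.2
  refine csSup_le (feasible_nonempty hW hμ hσ hρ _ hΔ.1) fun z hz => ?_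
  by_contra! hlt
  have h1 := feasible_of_le hμ hσ hρ hlt.le hz L hL0.le
  have e1 : L - (u₀ μ σ ρ - v + (1 + ε) * L) + u₀ μ σ ρ = v - ε * L := by ring
  rw [e1] at h1
  have hq : 0 < √Δ := Real.sqrt_pos.2 hΔ.1
  have hh := (abs_le.1 (abs_h_sub_le_sqrt hμ hσ hL0.le hΔ.1 hΔ.2)).1
  rw [← hC] at hh
  have hp0 := p_nonneg (P := P) (W := W) μ σ L Δ
  have hp1 := p_scale_le hW hμ hσ hΔ.1 hΔ.2
  rw [← hL] at hp1
  rw [lt_div_iff₀ (by positivity)] at hL1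
  have h2 : B - (1 + ε) * L - B * (2 * √Δ) ≤ (B - (1 + ε) * L) * (1 - p P W μ σ L Δ) := by
    have e2 : (B - (1 + ε) * L) * p P W μ σ L Δ ≤ B * (2 * √Δ) :=
      mul_le_mul (by nlinarith) hp1 hp0 hB0.le
    linarith
  have h3 : V₀ μ σ ρ (v - ε * L) ≤ B - (1 + κ) * (ε * L) := by
    have e3 := deriv_V₀_mul_sub_le hμ hσ hρ (show v - ε * L ≤ v by nlinarith) hv'.le
    have e4 : v - (v - ε * L) = ε * L := by ring
    rw [e4] at e3
    have e5 : 1 + κ = deriv (V₀ μ σ ρ) v := by rw [hκ]; ring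
    rw [e5]
    linarith
  have hρΔ : ρ * Δ ≤ 1 := by
    have := hΔρ.2
    rw [lt_div_iff₀ hρ] at this
    linarith
  have hρΔ0 : 0 < ρ * Δ := mul_pos hρ hΔ.1
  have h4 : Real.exp (ρ * Δ) - 1 ≤ 2 * ρ * √Δ := by
    have e6 := Real.abs_exp_sub_one_le (x := ρ * Δ) (by rwa [abs_of_pos hρΔ0])
    rw [abs_of_pos hρΔ0] at e6
    have e7 : Δ ≤ √Δ := Real.le_sqrt_of_sq_le (by nlinarith [hΔ.1, hΔ.2])
    have e8 := mul_le_mul_of_nonneg_left e7 hρ.le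
    linarith [le_abs_self (Real.exp (ρ * Δ) - 1)]
  have h5 : Real.exp (ρ * Δ) * V₀ μ σ ρ (v - ε * L) ≤ V₀ μ σ ρ (v - ε * L) + 2 * ρ * √Δ * B := by
    have e9 : V₀ μ σ ρ (v - ε * L) ≤ B :=
      (strictMono_V₀ hμ hσ hρ).monotone (by nlinarith)
    have hE1 : 0 ≤ Real.exp (ρ * Δ) - 1 := by linarith [Real.one_le_exp hρΔ0.le]
    have e10 := mul_le_mul_of_nonneg_left e9 hE1
    have e11 := mul_le_mul_of_nonneg_right h4 hB0.le
    linarith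
  rw [div_mul_eq_mul_div, le_div_iff₀ (by positivity)] at hs
  have h6 : 0 < κ * ε * L := by positivity
  have h7 : D * √Δ = 2 * B * √Δ + C * √Δ + 2 * ρ * B * √Δ := by rw [hD]; ring
  nlinarith

theorem eventually_le_csSup_feasible (hW : IsBrownianReal W P) (hμ : 0 < μ) (hσ : 0 < σ)
    (hρ : 0 < ρ) {v : ℝ} (hv : 0 < v) (hv' : v < u₀ μ σ ρ) {ε : ℝ} (hε : 0 < ε) (hε' : ε < 1) :
    ∀ᶠ Δ in 𝓝[>] 0, u₀ μ σ ρ - v + (1 - ε) * scale σ Δ ≤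
      sSup (feasible P W μ σ ρ (V₀ μ σ ρ v - (1 - ε) * scale σ Δ) Δ) := by
  filter_upwards [Ioo_mem_nhdsGT one_pos,
    -- For l = (1 - ε)L and margin ε/2 the two ranges of the gap meet at (1 - ε/2)L, so they cover
    -- all x ≥ 0.
    eventually_gap hW hμ hσ hρ hv hv' (half_pos hε) (by linarith)] with Δ hΔ hgap
  set L := scale σ Δ with hL
  have hL0 : 0 < L := scale_pos hσ hΔ.1 hΔ.2
  refine le_csSup (bddAbove_feasible hW hμ hσ hρ _ hΔ.1) fun x hx => ?_
  have hx' : x ≤ (1 - ε / 2) * L ∨ (1 - ε) * L + ε / 2 * L ≤ x := by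
    rcases le_total x ((1 - ε / 2) * L) with h | h
    · exact Or.inl h
    · exact Or.inr (by linarith)
  refine (hgap ((1 - ε) * L) (by nlinarith) (by nlinarith) x hx hx').trans ?_
  exact mul_le_mul_of_nonneg_left ((strictMono_V₀ hμ hσ hρ).monotone
    (by linarith [Real.sqrt_nonneg Δ])) (Real.exp_pos _).le

/-- If equality does not hold at any `x > 0`, then the threshold could be increased. -/
theorem exists_eq_of_gap (hW : IsBrownianReal W P) (hμ : 0 < μ) (hσ : 0 < σ) (hρ : 0 < ρ)
    {v l a b δ Δ : ℝ} (hΔ : 0 < Δ) (hδ : 0 < δ) (ha : 0 < a) (hab : a ≤ b)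
    (hβ : 0 ≤ V₀ μ σ ρ v - l) (hleft : 0 ≤ v + a - l - δ) (hright : v + b - l ≤ u₀ μ σ ρ)
    (hsup : sSup (feasible P W μ σ ρ (V₀ μ σ ρ v - l) Δ) = u₀ μ σ ρ - v + l)
    (hgap : ∀ x ≥ 0, (x ≤ a ∨ b ≤ x) →
      (V₀ μ σ ρ v - l) * (1 - p P W μ σ x Δ) + h μ σ x Δ ≤
        Real.exp (ρ * Δ) * V₀ μ σ ρ (v + x - l - δ)) :
    ∃ x, 0 < x ∧ (V₀ μ σ ρ v - l) * (1 - p P W μ σ x Δ) + h μ σ x Δ =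
        Real.exp (ρ * Δ) * V₀ μ σ ρ (v + x - l) := by
  by_contra! hne
  set β := V₀ μ σ ρ v - l with hβdef
  set E := Real.exp (ρ * Δ) with hE
  have hE0 : 0 < E := Real.exp_pos _
  set M := deriv (V₀ μ σ ρ) 0 with hM
  have hM1 : 1 ≤ M := one_le_deriv_V₀ hμ hσ hρ 0
  have hmem := csSup_feasible_mem hW hμ hσ hρ β hΔ
  rw [hsup] at hmem
  have hle : ∀ x ≥ 0, β * (1 - p P W μ σ x Δ) + h μ σ x Δ ≤ E * V₀ μ σ ρ (v + x - l) := by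
    intro x hx
    have := hmem x hx
    have e : x - (u₀ μ σ ρ - v + l) + u₀ μ σ ρ = v + x - l := by ring
    rwa [e] at this
  have hI : Set.Icc a b ⊆ Set.Ioi 0 := fun x hx => ha.trans_le hx.1
  -- The slack of the inequality. If equality never occurs, it has a positive minimum m on [a, b].
  have hlsc : LowerSemicontinuousOn (fun x => β * p P W μ σ x Δ +
      (E * V₀ μ σ ρ (v + x - l) - β - h μ σ x Δ)) (Set.Icc a b) := by
    refine LowerSemicontinuousOn.add ?_ (ContinuousOn.lowerSemicontinuousOn ?_)
    · exact (continuous_const_mul β).comp_lowerSemicontinuousOn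
        ((lowerSemicontinuousOn_p hW hσ).mono hI) (monotone_mul_left_of_nonneg hβ)
    · refine ContinuousOn.sub ?_ ((continuousOn_h hμ hσ hΔ).mono fun x hx =>
        (Set.mem_Ioi.1 (hI hx)).le)
      have := (continuous_V₀ (μ := μ) (σ := σ) (ρ := ρ)).comp
        (show Continuous fun x : ℝ => v + x - l by fun_prop)
      exact ((continuous_const.mul this).sub continuous_const).continuousOn
  obtain ⟨x₀, hx₀, hmin⟩ := hlsc.exists_isMinOn (Set.nonempty_Icc.2 hab) isCompact_Icc
  set m := β * p P W μ σ x₀ Δ + (E * V₀ μ σ ρ (v + x₀ - l) - β - h μ σ x₀ Δ) with hm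
  have hm0 : 0 < m := by
    have := lt_of_le_of_ne (hle x₀ (hI hx₀).le) (hne x₀ (hI hx₀))
    rw [hm]
    linarith
  -- On [a, b] raising z by δ' costs at most e^{ρΔ}Mδ' ≤ m; outside, the assumed room δ suffices.
  -- This contradicts the choice of z as the supremum.
  set δ' := min δ (m / (E * M)) with hδ'
  have hδ'0 : 0 < δ' := lt_min hδ (by positivity)
  have hnew : u₀ μ σ ρ - v + l + δ' ∈ feasible P W μ σ ρ β Δ := by
    intro x hx
    have e : x - (u₀ μ σ ρ - v + l + δ') + u₀ μ σ ρ = v + x - l - δ' := by ring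
    rw [e]
    by_cases hxI : a ≤ x ∧ x ≤ b
    · have h1 : m ≤ β * p P W μ σ x Δ + (E * V₀ μ σ ρ (v + x - l) - β - h μ σ x Δ) := hmin hxI
      have hδδ : δ' ≤ δ := min_le_left _ _
      have h2 := V₀_sub_le_deriv_mul hμ hσ hρ
        (show v + x - l - δ' ≤ v + x - l by linarith) (by linarith)
      have h3 : deriv (V₀ μ σ ρ) (v + x - l - δ') ≤ M :=
        (strictAntiOn_deriv_V₀ hμ hσ hρ).antitoneOn (V₀_spec hμ hσ hρ).1.le
          (show v + x - l - δ' ≤ _ by linarith) (by linarith)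
      have e4 : v + x - l - (v + x - l - δ') = δ' := by ring
      rw [e4] at h2
      have h4 := mul_le_mul_of_nonneg_right h3 hδ'0.le
      have h5 : E * (M * δ') ≤ m := by
        have : δ' ≤ m / (E * M) := min_le_right _ _
        rw [le_div_iff₀ (by positivity)] at this
        linarith
      have h6 : E * (V₀ μ σ ρ (v + x - l) - V₀ μ σ ρ (v + x - l - δ')) ≤ E * (M * δ') :=
        mul_le_mul_of_nonneg_left (h2.trans h4) hE0.le
      linarith
    · have hx' : x ≤ a ∨ b ≤ x := by
        by_contra! hcon
        exact hxI ⟨hcon.1.le, hcon.2.le⟩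
      refine (hgap x hx hx').trans (mul_le_mul_of_nonneg_left
        ((strictMono_V₀ hμ hσ hρ).monotone ?_) hE0.le)
      linarith [min_le_left δ (m / (E * M))]
  have := le_csSup (bddAbove_feasible hW hμ hσ hρ β hΔ) hnew
  rw [hsup] at this
  linarith

/-- The thresholds are located at the scale up to a relative error `2 ε`. -/
theorem eventually_thresholds (hW : IsBrownianReal W P) (hμ : 0 < μ) (hσ : 0 < σ) (hρ : 0 < ρ)
    {K : ℝ} (hK : 0 < K) (hK' : K < μ / ρ - u₀ μ σ ρ) {ε : ℝ} (hε : 0 < ε) (hε' : ε < 1) :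
    ∀ᶠ Δ in 𝓝[>] 0, |u₁K P W μ σ ρ K Δ - scale σ Δ| ≤ 2 * ε * scale σ Δ ∧
      |u₂K P W μ σ ρ K Δ - (u₀ μ σ ρ - uHat μ σ ρ K) - scale σ Δ| ≤ 2 * ε * scale σ Δ := by
  obtain ⟨hv, hv', hvK⟩ := uHat_spec hμ hσ hρ hK hK'
  set v := uHat μ σ ρ K with hvdef
  have hB0 : 0 < V₀ μ σ ρ v := by
    rw [← (V₀_spec hμ hσ hρ).2.2.1]
    exact strictMono_V₀ hμ hσ hρ hv
  have hbeta := tendsto_betaCrit hW hμ hσ (ρ := ρ)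
  filter_upwards [Ioo_mem_nhdsGT one_pos,
    eventually_csSup_feasible_le hW hμ hσ hρ hv hv' hε,
    eventually_le_csSup_feasible hW hμ hσ hρ hv hv' hε hε',
    eventually_gap hW hμ hσ hρ hv hv' hε hε',
    hbeta.eventually_lt_const (show 0 < μ / ρ - u₀ μ σ ρ - K by linarith),
    hbeta.eventually_lt_const (show 0 < V₀ μ σ ρ v / 2 by positivity),
    eventually_sqrt_le_mul_scale hσ one_pos,
    (tendsto_scale σ).eventually_lt_const (show 0 < V₀ μ σ ρ v / 4 by positivity),
    (tendsto_scale σ).eventually_lt_const (show 0 < v / 3 by positivity),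
    (tendsto_scale σ).eventually_lt_const (show 0 < u₀ μ σ ρ - v by linarith)]
    with Δ hΔ hupper hlower hgap hcond hcrit hs hL1 hL2 hL3
  set L := scale σ Δ with hL
  have hL0 : 0 < L := scale_pos hσ hΔ.1 hΔ.2
  have hεL : ε * L < L := mul_lt_of_lt_one_left hL0 hε'
  have hεL0 : 0 < ε * L := mul_pos hε hL0
  set B := V₀ μ σ ρ v with hB
  set m : ℝ → ℝ := fun β => β + sSup (feasible P W μ σ ρ β Δ) with hm
  have hmono : StrictMono m := strictMono_add_csSup_feasible hW hμ hσ hρ hΔ.1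
  have hmcont : Continuous m := continuous_id.add (continuous_csSup_feasible hW hμ hσ hρ hΔ.1)
  -- By the equation for û_K, μ/ρ - K = B + u₀ - v, so the multiples of L cancel in both bounds.
  have hm1 : m (B - (1 + ε) * L) ≤ μ / ρ - K := by simp only [hm]; linarith
  have hm2 : μ / ρ - K ≤ m (B - (1 - ε) * L) := by simp only [hm]; linarith
  -- existence of the level
  have hex : ∃ β, betaCrit P W μ σ ρ Δ < β ∧ β + u₂ P W μ σ ρ β Δ = μ / ρ - K := by
    obtain ⟨β, hβ, hβm⟩ := intermediate_value_Icc
      (show B - (1 + ε) * L ≤ B - (1 - ε) * L by linarith) hmcont.continuousOn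
      (show μ / ρ - K ∈ Set.Icc _ _ from ⟨hm1, hm2⟩)
    have hβc : betaCrit P W μ σ ρ Δ < β := by linarith [hβ.1]
    exact ⟨β, hβc, by rw [u₂_of_gt hβc]; exact hβm⟩
  have hspec := Classical.epsilon_spec hex
  change betaCrit P W μ σ ρ Δ < betaK P W μ σ ρ K Δ ∧
    betaK P W μ σ ρ K Δ + u₂ P W μ σ ρ (betaK P W μ σ ρ K Δ) Δ = μ / ρ - K at hspec
  have e1 : u₁K P W μ σ ρ K Δ = u₁ P W μ σ ρ (betaK P W μ σ ρ K Δ) Δ := if_pos (by linarith)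
  have e2 : u₂K P W μ σ ρ K Δ = u₂ P W μ σ ρ (betaK P W μ σ ρ K Δ) Δ := if_pos (by linarith)
  rw [e1, e2]
  generalize betaK P W μ σ ρ K Δ = β at hspec
  obtain ⟨hβc, hβm⟩ := hspec
  have hmβ : m β = μ / ρ - K := by rw [u₂_of_gt hβc] at hβm; exact hβm
  have hβ1 : B - (1 + ε) * L ≤ β := hmono.le_iff_le.1 (by linarith)
  have hβ2 : β ≤ B - (1 - ε) * L := hmono.le_iff_le.1 (by linarith)
  set l := B - β with hl
  have hβl : β = B - l := by rw [hl]; ring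
  have hsup : u₂ P W μ σ ρ β Δ = u₀ μ σ ρ - v + l := by linarith
  constructor
  · have harg : ∀ x, x - u₂ P W μ σ ρ β Δ + u₀ μ σ ρ = v + x - l := fun x => by
      rw [hsup]; ring
    have hgapl := hgap l (by linarith) (by linarith)
    have hexx : ∃ x, 0 < x ∧ β * (1 - p P W μ σ x Δ) + h μ σ x Δ =
        Real.exp (ρ * Δ) * V₀ μ σ ρ (x - u₂ P W μ σ ρ β Δ + u₀ μ σ ρ) := by
      have hq : 0 < √Δ := Real.sqrt_pos.2 hΔ.1
      obtain ⟨x, hx, hxeq⟩ := exists_eq_of_gap hW hμ hσ hρ (v := v) (l := l)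
        (a := (1 - ε) * L) (b := l + ε * L) hΔ.1 hq (by linarith) (by linarith) (by linarith)
        (by linarith) (by linarith) (by rw [← hβl, ← u₂_of_gt hβc, hsup]) hgapl
      exact ⟨x, hx, by rw [harg, ← hxeq, ← hB, ← hβl]⟩
    have hspec := Classical.epsilon_spec hexx
    change 0 < u₁ P W μ σ ρ β Δ ∧ β * (1 - p P W μ σ (u₁ P W μ σ ρ β Δ) Δ) +
      h μ σ (u₁ P W μ σ ρ β Δ) Δ = Real.exp (ρ * Δ) *
        V₀ μ σ ρ (u₁ P W μ σ ρ β Δ - u₂ P W μ σ ρ β Δ + u₀ μ σ ρ) at hspec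
    generalize u₁ P W μ σ ρ β Δ = x at hspec
    obtain ⟨hx, hxeq⟩ := hspec
    rw [harg] at hxeq
    -- The gap holds with z larger by √Δ, so strict monotonicity of V₀ forbids equality there. Every
    -- contact point is thus confined to ((1 - ε)L, l + εL), whichever one is chosen.
    have hnot : ¬ (x ≤ (1 - ε) * L ∨ l + ε * L ≤ x) := by
      intro hcase
      have h1 := hgapl x hx.le hcase
      rw [← hβl, hxeq] at h1
      have h2 := (strictMono_V₀ hμ hσ hρ).le_iff_le.1 (le_of_mul_le_mul_left h1 (Real.exp_pos _))
      linarith [Real.sqrt_pos.2 hΔ.1]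
    push Not at hnot
    rw [abs_le]
    constructor <;> linarith [hnot.1, hnot.2]
  · rw [hsup, abs_le]
    constructor <;> linarith

/-! ### From relative error bounds to the limits -/

theorem tendsto_div_scale_of_eventually (hσ : 0 < σ) {f : ℝ → ℝ}
    (hf : ∀ ε > 0, ε < 1 → ∀ᶠ Δ in 𝓝[>] 0, |f Δ - scale σ Δ| ≤ 2 * ε * scale σ Δ) :
    Tendsto (fun Δ => f Δ / scale σ Δ) (𝓝[>] 0) (𝓝 1) := by
  rw [Metric.tendsto_nhds]
  intro η hη
  filter_upwards [Ioo_mem_nhdsGT one_pos, hf (min (η / 4) (1 / 2)) (by positivity)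
    ((min_le_right _ _).trans_lt (by norm_num))] with Δ hΔ h1
  have hL0 : 0 < scale σ Δ := scale_pos hσ hΔ.1 hΔ.2
  rw [Real.dist_eq, div_sub_one hL0.ne', abs_div, abs_of_pos hL0, div_lt_iff₀ hL0]
  refine h1.trans_lt (mul_lt_mul_of_pos_right ?_ hL0)
  linarith [min_le_left (η / 4) (1 / 2)]

end BankModel

theorem proposition4p1 {Ω : Type*} [MeasurableSpace Ω] (P : Measure Ω) (W : ℝ≥0 → Ω → ℝ)
    (hW : IsBrownianReal W P) (μ σ ρ K : ℝ) (hμ : 0 < μ) (hσ : 0 < σ) (hρ : 0 < ρ)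
    (hK : 0 < K) (hK' : K < μ / ρ - BankModel.u₀ μ σ ρ) :
    Tendsto (fun Δ : ℝ => BankModel.u₁K P W μ σ ρ K Δ / (σ * √Δ * √|Real.log Δ|))
      (𝓝[>] 0) (𝓝 1) ∧
    Tendsto (fun Δ : ℝ =>
        (BankModel.u₂K P W μ σ ρ K Δ - (BankModel.u₀ μ σ ρ - BankModel.uHat μ σ ρ K)) /
          (σ * √Δ * √|Real.log Δ|))
      (𝓝[>] 0) (𝓝 1) :=
  ⟨BankModel.tendsto_div_scale_of_eventually hσ fun _ hε hε' =>
      (BankModel.eventually_thresholds hW hμ hσ hρ hK hK' hε hε').mono fun _ h => h.1,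
    BankModel.tendsto_div_scale_of_eventually hσ fun _ hε hε' =>
      (BankModel.eventually_thresholds hW hμ hσ hρ hK hK' hε hε').mono fun _ h => h.2⟩
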